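/- A \emph{Boolean circuit} $C$ is a finite directed acyclic graph whose vertices (\emph{gates}) have a type among var, NOT, OR, AND, with a distinguished output gate; NOT-gates have exactly one input, var-gates have none, and OR- and AND-gates have any number of inputs. A \emph{tree decomposition} of $C$ is a finite rooted tree $T$ whose nodes $b$ are labelled by sets of gates (\emph{bags}) such that the two ends of every wire lie together in some bag and, for every gate, the nodes whose bag contains it form a (nonempty) connected subtree; its \emph{width} is the maximal size of a bag minus one, and $|T|$ is its number of nodes. A \emph{probability valuation} $\pi$ of $C$ maps each variable gate $g$ to a real number $\pi(g)\in[0,1]$; $|\pi|$ is the number of variable gates (one memory cell per probability), and $\pi(C)$ is the probability that $C$ evaluates to true when each variable gate $g$ is true with probability $\pi(g)$, independently of the others. The machine is a word RAM with additional memory for real numbers, on which only sum and product (with integer constants available) can be performed. Each integer operation on words, each sum or product of reals, and each memory access takes one unit of time. \textbf{Corollary.} There are a program $P$ for this machine and a constant $d$ such that for every $\varepsilon>0$ there is a constant $c$ with the following property. For every Boolean circuit $C$ (given by the numbered list of its gates with their types, its output gate, and the list of its wires in any order), every tree decomposition $T$ of $C$ (given by its root, the parent of each node, and the list of the gates of each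 bag in any order), of width $k$, and every probability valuation $\pi$ of $C$, the program $P$ on input $(C,T,\pi)$ halts with output exactly $\pi(C)$ after at most $$c\cdot\left(|\pi|+|T|\cdot 2^{(4+\varepsilon)k}\right)$$ units of time, and all integers that it handles are less than $\big((|\pi|+|T|+1)\cdot 2^k\big)^d$, i.e., words of $O(\log(|\pi|+|T|)+k)$ bits (with $|\pi|+|T|+1\ge 2$) suffice. -/

import Mathlib

/-! Boolean circuits, tree decompositions, probability of a circuit, and a word RAM that
also has real registers with unit-cost sum and product. -/

namespace CircuitProb

/-! ### Boolean circuits -/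

/-- The types of gates. -/
inductive GateType
  | var
  | not
  | or
  | and
  deriving DecidableEq

/-- A Boolean circuit: a directed acyclic graph whose vertices (gates) carry a type.
`Wire g' g` says that `g'` is an input of `g`. Fan-in of and-gates and or-gates is arbitrary
(possibly zero). -/
structure Circuit (G : Type) where
  Wire : G → G → Prop
  output : G
  type : G → GateType
  acyclic : ∀ g, ¬ Relation.TransGen Wire g g
  fanIn_not : ∀ g, type g = GateType.not → ∃! g', Wire g' g
  fanIn_var : ∀ g, type g = GateType.var → ∀ g', ¬ Wire g' g

namespace Circuit

variable {G : Type}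

/-- The variable gates. -/
abbrev Var (C : Circuit G) : Type := {g : G // C.type g = GateType.var}

theorem wellFounded_wire [Finite G] (C : Circuit G) : WellFounded C.Wire := by
  have : Std.Irrefl (Relation.TransGen C.Wire) := ⟨C.acyclic⟩
  have h : WellFounded (Relation.TransGen C.Wire) :=
    Finite.wellFounded_of_trans_of_irrefl _
  exact Subrelation.wf (fun hab => Relation.TransGen.single hab) h

open Classical in
/-- The value of a gate, given the values of its inputs. -/
noncomputable def step (C : Circuit G) (ν : C.Var → Bool) (g : G)
    (e : (g' : G) → C.Wire g' g → Bool) : Bool :=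
  if hg : C.type g = GateType.var then ν ⟨g, hg⟩
  else match C.type g with
    | GateType.not => decide (∃ (g' : G) (h : C.Wire g' g), e g' h = false)
    | GateType.and => decide (∀ (g' : G) (h : C.Wire g' g), e g' h = true)
    | _ => decide (∃ (g' : G) (h : C.Wire g' g), e g' h = true)

/-- The evaluation of all gates that extends the valuation `ν` of the variable gates. -/
noncomputable def eval [Finite G] (C : Circuit G) (ν : C.Var → Bool) : G → Bool :=
  C.wellFounded_wire.fix (C.step ν)

theorem eval_eq [Finite G] (C : Circuit G) (ν : C.Var → Bool) (g : G) :
    C.eval ν g = C.step ν g (fun g' _ => C.eval ν g') :=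
  C.wellFounded_wire.fix_eq _ g

/-- The probability that the circuit evaluates to true when every variable gate `g` is true
with probability `π g`, independently of the others. -/
noncomputable def prob [Fintype G] [DecidableEq G] (C : Circuit G)
    (π : C.Var → unitInterval) : ℝ :=
  ∑ ν : C.Var → Bool,
    if C.eval ν C.output = true then
      ∏ g : C.Var, (if ν g = true then (π g : ℝ) else 1 - (π g : ℝ))
    else 0

end Circuit

/-! ### Tree decompositions -/

/-- A tree decomposition of (the graph underlying) a circuit. The bags are the nodes `B` of a
rooted tree, given by its parent function (the root is its own parent, and every node has the
root as an ancestor); `bag b` is the set of gates that labels `b`. The last field says that the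
nodes whose label contains a gate form a (nonempty) connected subtree. -/
structure TreeDecomposition {G : Type} (C : Circuit G) (B : Type) where
  root : B
  parent : B → B
  parent_root : parent root = root
  reach_root : ∀ b, ∃ j : ℕ, parent^[j] b = root
  bag : B → Finset G
  wire_covered : ∀ g' g, C.Wire g' g → ∃ b, g' ∈ bag b ∧ g ∈ bag b
  connected : ∀ g,
    ((SimpleGraph.fromRel (fun b b' => parent b = b')).induce {b | g ∈ bag b}).Connected

/-- The width: the maximal size of a bag, minus one. (The maximum is at least one, since the
output gate occurs in some bag.) -/
def TreeDecomposition.width {G : Type} {C : Circuit G} {B : Type} [Fintype B]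
    (T : TreeDecomposition C B) : ℕ :=
  (Finset.univ.sup fun b => (T.bag b).card) - 1

/-! ### The machine -/

/-- A store: integer registers, integer arrays, real registers, real arrays. A program names
registers and arrays by constants, so it uses finitely many of them; the index into an array is
computed at run time. -/
structure Store where
  ivar : ℕ → ℕ
  iarr : ℕ → ℕ → ℕ
  rvar : ℕ → ℝ
  rarr : ℕ → ℕ → ℝ

/-- Integer expressions. -/
inductive IExp
  | lit (z : ℕ)
  | var (x : ℕ)
  | get (a : ℕ) (i : IExp)
  | add (e f : IExp)
  | sub (e f : IExp)
  | mul (e f : IExp)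
  | div (e f : IExp)

namespace IExp

/-- The value. Subtraction is truncated at 0, division rounds down (and gives 0 on divisor 0). -/
def val (s : Store) : IExp → ℕ
  | lit z => z
  | var x => s.ivar x
  | get a i => s.iarr a (i.val s)
  | add e f => e.val s + f.val s
  | sub e f => e.val s - f.val s
  | mul e f => e.val s * f.val s
  | div e f => e.val s / f.val s

/-- All values that occur during the evaluation are machine words, that is, less than `W`. -/
def Fits (W : ℕ) (s : Store) : IExp → Prop
  | lit z => z < W
  | var x => s.ivar x < W
  | get a i => i.Fits W s ∧ s.iarr a (i.val s) < W
  | add e f => e.Fits W s ∧ f.Fits W s ∧ e.val s + f.val s < W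
  | sub e f => e.Fits W s ∧ f.Fits W s
  | mul e f => e.Fits W s ∧ f.Fits W s ∧ e.val s * f.val s < W
  | div e f => e.Fits W s ∧ f.Fits W s

/-- Every constant, read access and operation takes one unit of time. -/
def cost : IExp → ℕ
  | lit _ => 1
  | var _ => 1
  | get _ i => i.cost + 1
  | add e f => e.cost + f.cost + 1
  | sub e f => e.cost + f.cost + 1
  | mul e f => e.cost + f.cost + 1
  | div e f => e.cost + f.cost + 1

end IExp

/-- Tests; real numbers cannot be tested. -/
inductive BExp
  | lt (e f : IExp)
  | eq (e f : IExp)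
  | neg (p : BExp)
  | conj (p q : BExp)

namespace BExp

def Holds (s : Store) : BExp → Prop
  | lt e f => e.val s < f.val s
  | eq e f => e.val s = f.val s
  | neg p => ¬ p.Holds s
  | conj p q => p.Holds s ∧ q.Holds s

def Fits (W : ℕ) (s : Store) : BExp → Prop
  | lt e f => e.Fits W s ∧ f.Fits W s
  | eq e f => e.Fits W s ∧ f.Fits W s
  | neg p => p.Fits W s
  | conj p q => p.Fits W s ∧ q.Fits W s

def cost : BExp → ℕ
  | lt e f => e.cost + f.cost + 1
  | eq e f => e.cost + f.cost + 1
  | neg p => p.cost + 1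
  | conj p q => p.cost + q.cost + 1

end BExp

/-- Real expressions: integer constants, read accesses, sum and product. -/
inductive RExp
  | lit (z : ℤ)
  | var (x : ℕ)
  | get (a : ℕ) (i : IExp)
  | add (e f : RExp)
  | mul (e f : RExp)

namespace RExp

noncomputable def val (s : Store) : RExp → ℝ
  | lit z => (z : ℝ)
  | var x => s.rvar x
  | get a i => s.rarr a (i.val s)
  | add e f => e.val s + f.val s
  | mul e f => e.val s * f.val s

/-- The indices that are computed during the evaluation are machine words. -/
def Fits (W : ℕ) (s : Store) : RExp → Prop
  | lit _ => True
  | var _ => True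
  | get _ i => i.Fits W s
  | add e f => e.Fits W s ∧ f.Fits W s
  | mul e f => e.Fits W s ∧ f.Fits W s

def cost : RExp → ℕ
  | lit _ => 1
  | var _ => 1
  | get _ i => i.cost + 1
  | add e f => e.cost + f.cost + 1
  | mul e f => e.cost + f.cost + 1

end RExp

/-- Programs. -/
inductive Prog
  | skip
  | iset (x : ℕ) (e : IExp)
  | iput (a : ℕ) (i e : IExp)
  | rset (x : ℕ) (e : RExp)
  | rput (a : ℕ) (i : IExp) (e : RExp)
  | seq (p q : Prog)
  | ite (b : BExp) (p q : Prog)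
  | loop (b : BExp) (p : Prog)

namespace Store

def setI (s : Store) (x v : ℕ) : Store :=
  { s with ivar := Function.update s.ivar x v }

def putI (s : Store) (a i v : ℕ) : Store :=
  { s with iarr := Function.update s.iarr a (Function.update (s.iarr a) i v) }

noncomputable def setR (s : Store) (x : ℕ) (v : ℝ) : Store :=
  { s with rvar := Function.update s.rvar x v }

noncomputable def putR (s : Store) (a i : ℕ) (v : ℝ) : Store :=
  { s with rarr := Function.update s.rarr a (Function.update (s.rarr a) i v) }

end Store

/-- `Exec W p s t s'`: started in the store `s`, the program `p` halts in the store `s'` after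
exactly `t` units of time, and all integers that it handles are machine words, that is, less
than `W`. (A program that would handle a larger integer is stuck. `Prog.loop b p` repeats `p`
while `b` holds.) -/
inductive Exec (W : ℕ) : Prog → Store → ℕ → Store → Prop
  | skip (s : Store) : Exec W Prog.skip s 1 s
  | iset (x : ℕ) (e : IExp) (s : Store) (he : e.Fits W s) :
      Exec W (Prog.iset x e) s (e.cost + 1) (s.setI x (e.val s))
  | iput (a : ℕ) (i e : IExp) (s : Store) (hi : i.Fits W s) (he : e.Fits W s) :
      Exec W (Prog.iput a i e) s (i.cost + e.cost + 1) (s.putI a (i.val s) (e.val s))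
  | rset (x : ℕ) (e : RExp) (s : Store) (he : e.Fits W s) :
      Exec W (Prog.rset x e) s (e.cost + 1) (s.setR x (e.val s))
  | rput (a : ℕ) (i : IExp) (e : RExp) (s : Store) (hi : i.Fits W s) (he : e.Fits W s) :
      Exec W (Prog.rput a i e) s (i.cost + e.cost + 1) (s.putR a (i.val s) (e.val s))
  | seq (p q : Prog) (s s' s'' : Store) (t t' : ℕ)
      (hp : Exec W p s t s') (hq : Exec W q s' t' s'') :
      Exec W (Prog.seq p q) s (t + t') s''
  | ite_true (b : BExp) (p q : Prog) (s s' : Store) (t : ℕ)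
      (hf : b.Fits W s) (hb : b.Holds s) (hp : Exec W p s t s') :
      Exec W (Prog.ite b p q) s (b.cost + 1 + t) s'
  | ite_false (b : BExp) (p q : Prog) (s s' : Store) (t : ℕ)
      (hf : b.Fits W s) (hb : ¬ b.Holds s) (hq : Exec W q s t s') :
      Exec W (Prog.ite b p q) s (b.cost + 1 + t) s'
  | loop_true (b : BExp) (p : Prog) (s s' s'' : Store) (t t' : ℕ)
      (hf : b.Fits W s) (hb : b.Holds s) (hp : Exec W p s t s')
      (hl : Exec W (Prog.loop b p) s' t' s'') :
      Exec W (Prog.loop b p) s (b.cost + 1 + t + t') s''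
  | loop_false (b : BExp) (p : Prog) (s : Store)
      (hf : b.Fits W s) (hb : ¬ b.Holds s) :
      Exec W (Prog.loop b p) s (b.cost + 1) s

/-! ### The input of the machine -/

/-- The number that encodes a gate type. -/
def GateType.code : GateType → ℕ
  | var => 0
  | not => 1
  | or => 2
  | and => 3

/-- `ws` lists the wires of the circuit without repetition, in some order. -/
def Circuit.ListsWires {G : Type} (C : Circuit G) (ws : List (G × G)) : Prop :=
  ws.Nodup ∧ ∀ g' g, (g', g) ∈ ws ↔ C.Wire g' g

/-- For each node `b`, `bl b` lists the gates of the bag of `b` without repetition, in some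
order. -/
def TreeDecomposition.ListsBags {G : Type} {C : Circuit G} {B : Type}
    (T : TreeDecomposition C B) (bl : B → List G) : Prop :=
  ∀ b, (bl b).Nodup ∧ ∀ g, g ∈ bl b ↔ g ∈ T.bag b

/-- The total length of the lists `bl 0, …, bl (j - 1)`. -/
def bagOffset {n m : ℕ} (bl : Fin m → List (Fin n)) (j : ℕ) : ℕ :=
  (((List.finRange m).take j).flatMap bl).length

/-- The store that presents a circuit with gates `0, …, n - 1`, a tree decomposition with nodes
`0, …, m - 1`, and a probability valuation. All cells that are not mentioned are zero.

* registers: `0` number of gates, `1` output gate, `2` number of wires, `3` number of nodes,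
  `4` root;
* array `0`: the types of the gates; arrays `1` and `2`: the source and the target of the
  wires, in the order of `ws`;
* array `3`: the parent of each node; array `5`: the concatenation of all bags; array `4`: the
  position in array `5` where the bag of each node starts (the bag of `b` occupies the
  positions from `bagOffset bl b` up to, but excluding, `bagOffset bl (b + 1)`);
* real array `0`: the probability of each variable gate. -/
noncomputable def inputStore {n m : ℕ} (C : Circuit (Fin n)) (T : TreeDecomposition C (Fin m))
    (π : C.Var → unitInterval) (ws : List (Fin n × Fin n)) (bl : Fin m → List (Fin n)) :
    Store where
  ivar x := match x with
    | 0 => n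
    | 1 => C.output
    | 2 => ws.length
    | 3 => m
    | 4 => T.root
    | _ => 0
  iarr a j := match a with
    | 0 => if h : j < n then (C.type ⟨j, h⟩).code else 0
    | 1 => (ws.map fun w => (w.1 : ℕ)).getD j 0
    | 2 => (ws.map fun w => (w.2 : ℕ)).getD j 0
    | 3 => if h : j < m then (T.parent ⟨j, h⟩ : ℕ) else 0
    | 4 => if j ≤ m then bagOffset bl j else 0
    | 5 => (((List.finRange m).flatMap bl).map fun g => (g : ℕ)).getD j 0
    | _ => 0
  rvar _ := 0
  rarr a j := match a with
    | 0 => if h : ∃ hj : j < n, C.type ⟨j, hj⟩ = GateType.var then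
        (π ⟨⟨j, h.1⟩, h.2⟩ : ℝ) else 0
    | _ => 0

end CircuitProb

/-! The obstacle is that an and- or or-gate may have inputs scattered over many bags, so the
condition "the gate has the right value" is not local to a bag. Inclusion–exclusion makes it local.
For an and-gate, the indicator of a correct value is [all inputs true] if the gate is true, and 1 -
[all inputs true] if it is false. Each of the three terms 1, [all inputs true], -[all inputs true]
is a constant times a product over the incoming wires. Giving each gate a state that selects one of
these terms (or- and not-gates are similar; a variable gate uses two states to carry its
probability) turns the probability into a partition function on three states per gate, with one
weight per gate and one 0/1 constraint per wire. Summing over the states that induce fixed values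
gives back the indicator (`sum_states_eq`). Acyclicity leaves exactly one consistent extension of
each valuation of the variables (`prob_eq_partition`).

Such a partition function is computed by variable elimination along a tree decomposition. A bag `c`
whose children are done sends its parent `p` a message that sums out the gates of `c` outside `p`.
By connectedness these gates occur in no remaining bag, so the partition function is unchanged
(`partialSum_insert`, `mem_nodeBag_parent`). A gate's weight enters once, when the gate is
forgotten. A wire constraint may be tested in several bags, because it is idempotent. A virtual node
with empty bag above the root receives the final number (`tables_root`).

A message takes at most `3 ^ (k + 1)` states of the parent times as many of the child, with
O((k+1)²) work for each pair, hence O((k+1)² 9^k). Since 9 < 16 and (k+1)² is O(2^(εk)), this is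
within the bound (`exists_const`). Gates and wires all lie in bags, so preprocessing costs only |T|
times a polynomial in k. An order with children before parents comes from a queue of nodes whose
children have all been processed (`QueueInv`). The rest is a program logic with explicit time and
word bounds, applied to one fixed program. -/

namespace CircuitProb

/-! ### Stores -/

namespace Store

variable (s : Store)

@[simp] theorem setI_ivar (x v y : ℕ) : (s.setI x v).ivar y = if y = x then v else s.ivar y := by
  simp [setI, Function.update_apply]
@[simp] theorem setI_iarr (x v : ℕ) : (s.setI x v).iarr = s.iarr := rfl
@[simp] theorem setI_rvar (x v : ℕ) : (s.setI x v).rvar = s.rvar := rfl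
@[simp] theorem setI_rarr (x v : ℕ) : (s.setI x v).rarr = s.rarr := rfl

@[simp] theorem putI_ivar (a i v : ℕ) : (s.putI a i v).ivar = s.ivar := rfl
@[simp] theorem putI_iarr (a i v b : ℕ) :
    (s.putI a i v).iarr b = if b = a then Function.update (s.iarr a) i v else s.iarr b := by
  simp [putI, Function.update_apply]
@[simp] theorem putI_rvar (a i v : ℕ) : (s.putI a i v).rvar = s.rvar := rfl
@[simp] theorem putI_rarr (a i v : ℕ) : (s.putI a i v).rarr = s.rarr := rfl

@[simp] theorem setR_ivar (x : ℕ) (v : ℝ) : (s.setR x v).ivar = s.ivar := rfl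
@[simp] theorem setR_iarr (x : ℕ) (v : ℝ) : (s.setR x v).iarr = s.iarr := rfl
@[simp] theorem setR_rvar (x : ℕ) (v : ℝ) (y : ℕ) :
    (s.setR x v).rvar y = if y = x then v else s.rvar y := by
  simp [setR, Function.update_apply]
@[simp] theorem setR_rarr (x : ℕ) (v : ℝ) : (s.setR x v).rarr = s.rarr := rfl

@[simp] theorem putR_ivar (a i : ℕ) (v : ℝ) : (s.putR a i v).ivar = s.ivar := rfl
@[simp] theorem putR_iarr (a i : ℕ) (v : ℝ) : (s.putR a i v).iarr = s.iarr := rfl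
@[simp] theorem putR_rvar (a i : ℕ) (v : ℝ) : (s.putR a i v).rvar = s.rvar := rfl
@[simp] theorem putR_rarr (a i : ℕ) (v : ℝ) (b : ℕ) :
    (s.putR a i v).rarr b = if b = a then Function.update (s.rarr a) i v else s.rarr b := by
  simp [putR, Function.update_apply]

end Store

/-! ### What a program can change -/

namespace Prog

/-- The integer registers that a program assigns to. -/
def wI : Prog → List ℕ
  | iset x _ => [x]
  | seq p q => p.wI ++ q.wI
  | ite _ p q => p.wI ++ q.wI
  | loop _ p => p.wI
  | _ => []

/-- The integer arrays that a program writes to. -/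
def wIA : Prog → List ℕ
  | iput a _ _ => [a]
  | seq p q => p.wIA ++ q.wIA
  | ite _ p q => p.wIA ++ q.wIA
  | loop _ p => p.wIA
  | _ => []

/-- The real registers that a program assigns to. -/
def wR : Prog → List ℕ
  | rset x _ => [x]
  | seq p q => p.wR ++ q.wR
  | ite _ p q => p.wR ++ q.wR
  | loop _ p => p.wR
  | _ => []

/-- The real arrays that a program writes to. -/
def wRA : Prog → List ℕ
  | rput a _ _ => [a]
  | seq p q => p.wRA ++ q.wRA
  | ite _ p q => p.wRA ++ q.wRA
  | loop _ p => p.wRA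
  | _ => []

end Prog

/-- `s'` differs from `s` at most in the registers and arrays that `p` writes to. -/
structure Frame (p : Prog) (s s' : Store) : Prop where
  ivar : ∀ x, x ∉ p.wI → s'.ivar x = s.ivar x
  iarr : ∀ a, a ∉ p.wIA → s'.iarr a = s.iarr a
  rvar : ∀ x, x ∉ p.wR → s'.rvar x = s.rvar x
  rarr : ∀ a, a ∉ p.wRA → s'.rarr a = s.rarr a

namespace Frame

theorem rfl' (p : Prog) (s : Store) : Frame p s s :=
  ⟨fun _ _ => rfl, fun _ _ => rfl, fun _ _ => rfl, fun _ _ => rfl⟩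

theorem trans {p : Prog} {s s' s'' : Store} (h : Frame p s s') (h' : Frame p s' s'') :
    Frame p s s'' :=
  ⟨fun x hx => (h'.ivar x hx).trans (h.ivar x hx), fun x hx => (h'.iarr x hx).trans (h.iarr x hx),
    fun x hx => (h'.rvar x hx).trans (h.rvar x hx), fun x hx => (h'.rarr x hx).trans (h.rarr x hx)⟩

theorem mono {p q : Prog} {s s' : Store} (h : Frame p s s') (h1 : p.wI ⊆ q.wI)
    (h2 : p.wIA ⊆ q.wIA) (h3 : p.wR ⊆ q.wR) (h4 : p.wRA ⊆ q.wRA) : Frame q s s' :=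
  ⟨fun x hx => h.ivar x fun h' => hx (h1 h'), fun x hx => h.iarr x fun h' => hx (h2 h'),
    fun x hx => h.rvar x fun h' => hx (h3 h'), fun x hx => h.rarr x fun h' => hx (h4 h')⟩

end Frame

/-- The write sets are syntactic, so for a concrete program the preservation of unrelated data
reduces to a membership question that `decide` settles. -/
theorem Exec.frame {W : ℕ} {p : Prog} {s s' : Store} {t : ℕ} (h : Exec W p s t s') :
    Frame p s s' := by
  induction h with
  | skip s => exact Frame.rfl' _ _
  | iset x e s he =>
    refine ⟨fun y hy => ?_, fun _ _ => rfl, fun _ _ => rfl, fun _ _ => rfl⟩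
    simp [Prog.wI] at hy; simp [hy]
  | iput a i e s hi he =>
    refine ⟨fun _ _ => rfl, fun y hy => ?_, fun _ _ => rfl, fun _ _ => rfl⟩
    simp [Prog.wIA] at hy; simp [hy]
  | rset x e s he =>
    refine ⟨fun _ _ => rfl, fun _ _ => rfl, fun y hy => ?_, fun _ _ => rfl⟩
    simp [Prog.wR] at hy; simp [hy]
  | rput a i e s hi he =>
    refine ⟨fun _ _ => rfl, fun _ _ => rfl, fun _ _ => rfl, fun y hy => ?_⟩
    simp [Prog.wRA] at hy; simp [hy]
  | seq p q s s' s'' t t' _ _ h1 h2 =>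
    exact (h1.mono (by simp [Prog.wI]) (by simp [Prog.wIA]) (by simp [Prog.wR])
      (by simp [Prog.wRA])).trans (h2.mono (by simp [Prog.wI]) (by simp [Prog.wIA])
      (by simp [Prog.wR]) (by simp [Prog.wRA]))
  | ite_true b p q s s' t _ _ _ h1 =>
    exact h1.mono (by simp [Prog.wI]) (by simp [Prog.wIA]) (by simp [Prog.wR])
      (by simp [Prog.wRA])
  | ite_false b p q s s' t _ _ _ h1 =>
    exact h1.mono (by simp [Prog.wI]) (by simp [Prog.wIA]) (by simp [Prog.wR])
      (by simp [Prog.wRA])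
  | loop_true b p s s' s'' t t' _ _ _ _ h1 h2 =>
    exact Frame.trans (h1.mono (by simp [Prog.wI]) (by simp [Prog.wIA]) (by simp [Prog.wR])
      (by simp [Prog.wRA])) h2
  | loop_false b p s _ _ => exact Frame.rfl' _ _

/-! ### Total correctness with a time bound -/

/-- Started in `s`, the program `p` halts within `T` units of time in a store that
satisfies `Q`. -/
def Run (W : ℕ) (p : Prog) (s : Store) (T : ℕ) (Q : Store → Prop) : Prop :=
  ∃ t s', Exec W p s t s' ∧ t ≤ T ∧ Q s'

namespace Run

variable {W : ℕ} {p q : Prog} {s : Store} {T T' : ℕ} {Q R : Store → Prop}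

theorem mono (h : Run W p s T Q) (hT : T ≤ T') (hQ : ∀ s', Q s' → Frame p s s' → R s') :
    Run W p s T' R := by
  obtain ⟨t, s', h1, h2, h3⟩ := h
  exact ⟨t, s', h1, h2.trans hT, hQ s' h3 h1.frame⟩

theorem mono_time (h : Run W p s T Q) (hT : T ≤ T') : Run W p s T' Q :=
  h.mono hT fun _ h _ => h

theorem skip (h : Q s) : Run W Prog.skip s 1 Q := ⟨1, s, Exec.skip s, le_rfl, h⟩

theorem iset {x : ℕ} {e : IExp} (he : e.Fits W s) (h : Q (s.setI x (e.val s))) :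
    Run W (Prog.iset x e) s (e.cost + 1) Q :=
  ⟨_, _, Exec.iset x e s he, le_rfl, h⟩

theorem iput {a : ℕ} {i e : IExp} (hi : i.Fits W s) (he : e.Fits W s)
    (h : Q (s.putI a (i.val s) (e.val s))) : Run W (Prog.iput a i e) s (i.cost + e.cost + 1) Q :=
  ⟨_, _, Exec.iput a i e s hi he, le_rfl, h⟩

theorem rset {x : ℕ} {e : RExp} (he : e.Fits W s) (h : Q (s.setR x (e.val s))) :
    Run W (Prog.rset x e) s (e.cost + 1) Q :=
  ⟨_, _, Exec.rset x e s he, le_rfl, h⟩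

theorem rput {a : ℕ} {i : IExp} {e : RExp} (hi : i.Fits W s) (he : e.Fits W s)
    (h : Q (s.putR a (i.val s) (e.val s))) : Run W (Prog.rput a i e) s (i.cost + e.cost + 1) Q :=
  ⟨_, _, Exec.rput a i e s hi he, le_rfl, h⟩

theorem seq (hp : Run W p s T R) (hq : ∀ s', R s' → Frame p s s' → Run W q s' T' Q) :
    Run W (Prog.seq p q) s (T + T') Q := by
  obtain ⟨t, s', h1, h2, h3⟩ := hp
  obtain ⟨t', s'', h1', h2', h3'⟩ := hq s' h3 h1.frame
  exact ⟨_, _, Exec.seq _ _ _ _ _ _ _ h1 h1', Nat.add_le_add h2 h2', h3'⟩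

/-- Weakest-precondition form: the store after `p` stays explicit, which suits straight-line
assignments. `seq` instead forgets all but an assertion and the frame, which suits loops. -/
theorem seq_wp (hp : Run W p s T fun s' => Run W q s' T' Q) :
    Run W (Prog.seq p q) s (T + T') Q :=
  seq hp fun _ h _ => h

/-- The time bounds of both branches are added instead of maximised. This costs only a constant
factor and keeps all bounds sums. -/
theorem ite {b : BExp} (hf : b.Fits W s) (hp : b.Holds s → Run W p s T Q)
    (hq : ¬ b.Holds s → Run W q s T' Q) :
    Run W (Prog.ite b p q) s (b.cost + 1 + (T + T')) Q := by
  by_cases hb : b.Holds s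
  · obtain ⟨t, s', h1, h2, h3⟩ := hp hb
    exact ⟨_, _, Exec.ite_true _ _ _ _ _ _ hf hb h1, by omega, h3⟩
  · obtain ⟨t, s', h1, h2, h3⟩ := hq hb
    exact ⟨_, _, Exec.ite_false _ _ _ _ _ _ hf hb h1, by omega, h3⟩

end Run

/-! ### Counting loops -/

/-- Repeat `body` while the register `x` is less than the register `y`, incrementing `x`. -/
def forLoop (x y : ℕ) (body : Prog) : Prog :=
  Prog.loop (BExp.lt (IExp.var x) (IExp.var y))
    (Prog.seq body (Prog.iset x (IExp.add (IExp.var x) (IExp.lit 1))))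

/-- Each round pays 4 for the test and 4 for the increment, and the last test costs 4. The counter
may start at any `lo`, because bags are stored as segments of one array. The increment stays a word
because `lo + j + 1` is at most the upper limit. -/
theorem Run.forLoop {W x y lo N tb : ℕ} {body : Prog} {s : Store} (Inv : ℕ → Store → Prop)
    (hx : s.ivar x = lo) (hN : s.ivar y - lo = N) (hxW : lo < W) (hyW : s.ivar y < W)
    (h1W : 1 < W)
    (hxb : x ∉ body.wI) (hyb : y ∉ body.wI) (hxy : x ≠ y) (h0 : Inv 0 s)
    (hstep : ∀ j s', j < N → Inv j s' → Frame (forLoop x y body) s s' → s'.ivar x = lo + j →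
      Run W body s' tb fun s'' => Inv (j + 1) (s''.setI x (lo + j + 1))) :
    Run W (forLoop x y body) s (N * (tb + 8) + 4) (Inv N) := by
  have hy : y ∉ (CircuitProb.forLoop x y body).wI := by
    simp [CircuitProb.forLoop, Prog.wI, hyb, Ne.symm hxy]
  -- Induction on the number `r` of remaining rounds; the frame relative to the initial store `s` is
  -- carried along so that the limit in `y` is known in every round.
  have key : ∀ r j s', j + r = N → Inv j s' → Frame (CircuitProb.forLoop x y body) s s' →
      s'.ivar x = lo + j →
      Run W (CircuitProb.forLoop x y body) s' (r * (tb + 8) + 4) (Inv N) := by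
    intro r
    induction r with
    | zero =>
      intro j s' hj hI hF hxs
      have hys := hF.ivar y hy
      refine ⟨4, s', Exec.loop_false _ _ _ ?_ ?_, by omega, ?_⟩
      · simp only [BExp.Fits, IExp.Fits, hxs, hys]; omega
      · simp only [BExp.Holds, IExp.val, hxs, hys]; omega
      · have : j = N := by omega
        exact this ▸ hI
    | succ r ih =>
      intro j s' hj hI hF hxs
      have hys := hF.ivar y hy
      obtain ⟨t, s1, e1, ht1, hI1⟩ := hstep j s' (by omega) hI hF hxs
      have hx1 : s1.ivar x = lo + j := (e1.frame.ivar x hxb).trans hxs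
      have e2 : Exec W (Prog.seq body (Prog.iset x (IExp.add (IExp.var x) (IExp.lit 1)))) s'
          (t + 4) (s1.setI x (lo + j + 1)) := by
        have := Exec.iset (W := W) x (IExp.add (IExp.var x) (IExp.lit 1)) s1
          (by simp only [IExp.Fits, IExp.val, hx1]; omega)
        simp only [IExp.cost, IExp.val, hx1] at this
        exact Exec.seq _ _ _ _ _ _ _ e1 this
      have hF2 : Frame (CircuitProb.forLoop x y body) s (s1.setI x (lo + j + 1)) :=
        hF.trans (e2.frame.mono (by simp [CircuitProb.forLoop, Prog.wI])
          (by simp [CircuitProb.forLoop, Prog.wIA]) (by simp [CircuitProb.forLoop, Prog.wR])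
          (by simp [CircuitProb.forLoop, Prog.wRA]))
      obtain ⟨t', s2, e3, ht2, hI2⟩ := ih (j + 1) _ (by omega) hI1 hF2 (by simp; omega)
      refine ⟨_, s2, Exec.loop_true _ _ _ _ _ _ _ ?_ ?_ e2 e3, ?_, hI2⟩
      · simp only [BExp.Fits, IExp.Fits, hxs, hys]; omega
      · simp only [BExp.Holds, IExp.val, hxs, hys]; omega
      · simp only [BExp.cost, IExp.cost]
        have : (r + 1) * (tb + 8) = r * (tb + 8) + (tb + 8) := by ring
        omega
  exact key N 0 s (by omega) h0 (Frame.rfl' _ _) (by omega)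

/-! ### Loops over a bag -/

/-- The store holds `n` and `m` (in the registers 0, 3, 5) and, in the arrays 4 and 5, the
lists `L 0, …, L m`. -/
structure HoldsBags (W n m : ℕ) (L : ℕ → List (Fin n)) (s : Store) : Prop where
  n_eq : s.ivar 0 = n
  m_eq : s.ivar 3 = m
  m1_eq : s.ivar 5 = m + 1
  off_lt : ∀ b, b ≤ m + 1 → s.iarr 4 b < W
  off_sub : ∀ b, b ≤ m → s.iarr 4 (b + 1) - s.iarr 4 b = (L b).length
  get : ∀ b, b ≤ m → ∀ q (h : q < (L b).length), s.iarr 5 (s.iarr 4 b + q) = (L b)[q]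

/-- `s` and `s'` agree in all registers up to 5, the integer arrays up to `A` and the real
array 0. -/
structure Agree (A : ℕ) (s s' : Store) : Prop where
  ivar : ∀ x, x ≤ 5 → s'.ivar x = s.ivar x
  iarr : ∀ a, a ≤ A → s'.iarr a = s.iarr a
  rarr : s'.rarr 0 = s.rarr 0

namespace Agree

variable {A : ℕ} {s s' s'' : Store}

theorem trans (h : Agree A s s') (h' : Agree A s' s'') : Agree A s s'' :=
  ⟨fun x hx => (h'.ivar x hx).trans (h.ivar x hx), fun x hx => (h'.iarr x hx).trans (h.iarr x hx),
    h'.rarr.trans h.rarr⟩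

theorem of_frame {p : Prog} (h : Frame p s s') (h1 : ∀ x ∈ p.wI, 5 < x)
    (h2 : ∀ a ∈ p.wIA, A < a) (h3 : 0 ∉ p.wRA) : Agree A s s' :=
  ⟨fun x hx => h.ivar x fun h' => by have := h1 x h'; omega,
    fun x hx => h.iarr x fun h' => by have := h2 x h'; omega, h.rarr 0 h3⟩

theorem setI (A : ℕ) (s : Store) {x v : ℕ} (hx : 5 < x) : Agree A s (s.setI x v) :=
  ⟨fun y hy => by simp; omega, fun _ _ => rfl, rfl⟩

theorem setR (A : ℕ) (s : Store) {x : ℕ} {v : ℝ} : Agree A s (s.setR x v) :=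
  ⟨fun _ _ => rfl, fun _ _ => rfl, rfl⟩

end Agree

theorem HoldsBags.congr {W n m A : ℕ} {L : ℕ → List (Fin n)} {s s' : Store}
    (h : HoldsBags W n m L s) (hA : 5 ≤ A) (h' : Agree A s s') : HoldsBags W n m L s' := by
  have h4 := h'.iarr 4 (by omega)
  have h5 := h'.iarr 5 (by omega)
  refine ⟨?_, ?_, ?_, ?_, ?_, ?_⟩
  · rw [h'.ivar 0 (by omega), h.n_eq]
  · rw [h'.ivar 3 (by omega), h.m_eq]
  · rw [h'.ivar 5 (by omega), h.m1_eq]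
  · rw [h4]; exact h.off_lt
  · rw [h4]; exact h.off_sub
  · rw [h4, h5]; exact h.get

/-- Run `body` for all elements `g` of the bag whose number is in the register `bx`; the
registers `x` and `y` are used for counting. -/
def bagLoop (bx x y g : ℕ) (body : Prog) : Prog :=
  Prog.seq (Prog.iset x (IExp.get 4 (IExp.var bx)))
    (Prog.seq (Prog.iset y (IExp.get 4 (IExp.add (IExp.var bx) (IExp.lit 1))))
      (forLoop x y (Prog.seq (Prog.iset g (IExp.get 5 (IExp.var x))) body)))

/-- The invariant counts elements of the bag and has to survive any change of the counter `x`, so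
its users never see offsets into the concatenated bags. -/
theorem Run.bagLoop {W n m bx x y g b tb : ℕ} {L : ℕ → List (Fin n)} {body : Prog} {s : Store}
    (Inv : ℕ → Store → Prop)
    (hS : HoldsBags W n m L s) (hnW : n ≤ W) (hmW : m + 1 < W)
    (hb : s.ivar bx = b) (hbm : b ≤ m)
    (hd : [bx, x, y, g].Nodup) (hx5 : 5 < x) (hy5 : 5 < y) (hg5 : 5 < g)
    (hxb : x ∉ body.wI) (hyb : y ∉ body.wI) (hI5 : ∀ z ∈ body.wI, 5 < z)
    (hA5 : ∀ z ∈ body.wIA, 5 < z) (hR0 : 0 ∉ body.wRA)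
    (h0 : ∀ v v', Inv 0 ((s.setI x v).setI y v'))
    (hstep : ∀ j s', (hj : j < (L b).length) → Inv j s' →
      Frame (bagLoop bx x y g body) s s' →
      Run W body (s'.setI g (L b)[j]) tb fun s'' => ∀ v, Inv (j + 1) (s''.setI x v)) :
    Run W (bagLoop bx x y g body) s ((L b).length * (tb + 11) + 13) (Inv (L b).length) := by
  simp only [List.nodup_cons, List.mem_cons, not_or, List.not_mem_nil, or_false,
    not_false_eq_true, List.nodup_nil, and_true] at hd
  obtain ⟨⟨hbx, hby, hbg⟩, ⟨hxy, hxg⟩, hyg⟩ := hd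
  have e1 : s.iarr 4 b < W := hS.off_lt b (by omega)
  have e2 : s.iarr 4 (b + 1) < W := hS.off_lt (b + 1) (by omega)
  refine Run.mono_time (Run.seq_wp (Run.iset ?_ (Run.seq_wp (Run.iset ?_
    (Run.mono (Run.forLoop (lo := s.iarr 4 b) (N := (L b).length) (tb := tb + 3) Inv
      ?_ ?_ ?_ ?_ ?_ ?_ ?_ ?_ ?_ ?_) le_rfl fun _ h _ => h))))) ?_
  · simp [IExp.Fits, IExp.val, hb, e1]; omega
  · simp [IExp.Fits, IExp.val, hb, hbx, e2]; omega
  · simp [IExp.val, hb, hxy]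
  · simp [IExp.val, hb, hbx, hS.off_sub b hbm]
  · exact e1
  · simpa [IExp.val, hb, hbx] using e2
  · omega
  · simp [Prog.wI, hxg, hxb]
  · simp [Prog.wI, hyg, hyb]
  · exact hxy
  · exact h0 _ _
  · intro j s' hj hI hF hxs
    have hF' : Frame (CircuitProb.bagLoop bx x y g body) s s' := by
      have a1 := Exec.frame (Exec.iset (W := s.iarr 4 b + s.ivar bx + 1) x
        (IExp.get 4 (IExp.var bx)) s
        (by simp only [IExp.Fits, IExp.val, hb]; omega))
      have a2 := Exec.frame (Exec.iset
        (W := s.iarr 4 (b + 1) + s.ivar bx + 2) y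
        (IExp.get 4 (IExp.add (IExp.var bx) (IExp.lit 1)))
        (s.setI x ((IExp.get 4 (IExp.var bx)).val s))
        (by simp [IExp.Fits, IExp.val, hb, hbx]; omega))
      refine Frame.trans (a1.mono ?_ ?_ ?_ ?_) (Frame.trans (a2.mono ?_ ?_ ?_ ?_)
        (hF.mono ?_ ?_ ?_ ?_)) <;>
      simp [CircuitProb.bagLoop, Prog.wI, Prog.wIA, Prog.wR, Prog.wRA]
    have hS' : HoldsBags W n m L s' := by
      refine hS.congr le_rfl (Agree.of_frame hF' ?_ ?_ ?_)
      · simp only [CircuitProb.bagLoop, CircuitProb.forLoop, Prog.wI]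
        intro z hz
        simp only [List.mem_append, List.mem_singleton] at hz
        rcases hz with h | h | (h | h) | h
        all_goals first | omega | exact hI5 z h
      · simpa [CircuitProb.bagLoop, CircuitProb.forLoop, Prog.wIA] using hA5
      · simpa [CircuitProb.bagLoop, CircuitProb.forLoop, Prog.wRA] using hR0
    have h4 : s'.iarr 4 = s.iarr 4 := by
      refine hF'.iarr 4 ?_
      simp only [CircuitProb.bagLoop, CircuitProb.forLoop, Prog.wIA, List.nil_append,
        List.append_nil]
      intro h; exact absurd (hA5 4 h) (by omega)
    have hget := hS'.get b hbm j hj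
    rw [h4] at hget
    have hlt : s.iarr 4 b + j < W := by
      have := hS.off_sub b hbm
      omega
    refine Run.mono_time (T := 3 + tb) (Run.seq_wp (Run.iset ?_ ?_)) (by omega)
    · simp [IExp.Fits, IExp.val, hxs, hget, hlt]
      omega
    · have h : Run W body (s'.setI g (L b)[j]) tb
          fun s'' => Inv (j + 1) (s''.setI x (s.iarr 4 b + j + 1)) :=
        (hstep j s' hj hI hF').mono le_rfl fun s'' h _ => h _
      simpa [IExp.val, hxs, hget] using h
  · have : tb + 3 + 8 = tb + 11 := rfl
    simp only [IExp.cost, this]; omega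

/-! ### The probability as a partition function

Every gate gets one of three states. In the states `0` and `2` all its inputs must have the value
`true` (`false` for or-gates). The state `0` gives the gate the value that it then has, the
states `1` and `2` give it the other value; the state `2` has weight `-1`, so that the states `1`
and `2` cancel if all inputs have the said value. -/

/-- The value of a gate of type `t` in the state `d`. -/
def GateType.Val (t : GateType) (d : Fin 3) : Prop := d = 0 ↔ t = GateType.and

instance (t : GateType) (d : Fin 3) : Decidable (t.Val d) := by
  unfold GateType.Val; infer_instance

/-- The states `d'` of `g'` and `d` of `g` are compatible with a wire from `g'` to `g`. -/
def WireOK (t' t : GateType) (d' d : Fin 3) : Prop := d = 1 ∨ (t'.Val d' ↔ t ≠ GateType.or)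

instance (t' t : GateType) (d' d : Fin 3) : Decidable (WireOK t' t d' d) := by
  unfold WireOK; infer_instance

namespace Circuit

variable {G : Type} [Fintype G] [DecidableEq G] (C : Circuit G) (π : C.Var → unitInterval)

/-- The probability of a gate (`0` if it is not a variable gate). -/
noncomputable def gateProb (g : G) : ℝ :=
  if h : C.type g = GateType.var then (π ⟨g, h⟩ : ℝ) else 0

/-- The weight of the state `d` of `g`. -/
noncomputable def weight (g : G) (d : Fin 3) : ℝ :=
  if g = C.output ∧ ¬ (C.type g).Val d then 0
  else if C.type g = GateType.var then
    if d = 0 then 1 - C.gateProb π g else if d = 1 then C.gateProb π g else 0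
  else if d = 2 then -1 else 1

/-- The contribution of a gate with the value `x g` if all gates have the values `x`. -/
noncomputable def localFactor (x : G → Bool) (g : G) : ℝ :=
  if C.type g = GateType.var then if x g = true then C.gateProb π g else 1 - C.gateProb π g
  else if x g = C.step (fun v => x v) g (fun g' _ => x g') then 1 else 0

-- Let P say that all inputs of `g` are true (false for an or-gate). The value that state 0 gives to
-- `g` receives the sum [P]; the other value receives 1 - [P], from states 1 and 2. This is the
-- indicator that `g` is evaluated correctly. For a variable gate P is vacuous and the weights are
-- those of its two values.
open Classical in
theorem sum_states_eq (x : G → Bool) (g : G) :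
    (∑ d ∈ Finset.univ.filter (fun d => decide ((C.type g).Val d) = x g), C.weight π g d *
      (if ∀ g', C.Wire g' g → (d = 1 ∨ (x g' = true ↔ C.type g ≠ GateType.or)) then 1 else 0))
    = if g = C.output ∧ x g = false then 0 else C.localFactor π x g := by
  have e : ∀ d : Fin 3,
      (∀ g', C.Wire g' g → (d = 1 ∨ (x g' = true ↔ C.type g ≠ GateType.or))) ↔
        (d = 1 ∨ ∀ g', C.Wire g' g → (x g' = true ↔ C.type g ≠ GateType.or)) := by
    intro d
    by_cases hd : d = 1 <;> simp [hd]
  have hstep : C.type g ≠ GateType.var → C.step (fun v => x v) g (fun g' _ => x g') =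
      if C.type g = GateType.and then
        decide (∀ g', C.Wire g' g → (x g' = true ↔ C.type g ≠ GateType.or))
      else !decide (∀ g', C.Wire g' g → (x g' = true ↔ C.type g ≠ GateType.or)) := by
    intro hv
    rcases ht : C.type g with _ | _ | _ | _
    · exact absurd ht hv
    all_goals simp [step, ht, ← decide_not]
  have hvar : C.type g = GateType.var →
      ∀ g', C.Wire g' g → (x g' = true ↔ C.type g ≠ GateType.or) :=
    fun h g' hg' => absurd hg' (C.fanIn_var g h g')
  simp only [e]
  rw [Finset.sum_filter, Fin.sum_univ_three]
  unfold weight localFactor GateType.Val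
  obtain ⟨P, hP⟩ : ∃ P : Prop, (∀ g', C.Wire g' g → (x g' = true ↔ C.type g ≠ GateType.or)) ↔ P :=
    ⟨_, Iff.rfl⟩
  simp only [hP] at hstep hvar ⊢
  have h20 : ((2 : Fin 3) = 0) = False := by decide
  have h21 : ((2 : Fin 3) = 1) = False := by decide
  generalize C.gateProb π g = r
  generalize hy : C.step (fun v => x v) g (fun g' _ => x g') = y at *
  generalize x g = v at *
  obtain ⟨o, ho⟩ : ∃ o : Prop, (g = C.output) ↔ o := ⟨_, Iff.rfl⟩
  simp only [ho]
  generalize C.type g = t at *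
  rcases t with _ | _ | _ | _
  · have hP := hvar rfl
    by_cases ho : o <;> cases v <;> simp [ho, hP, h20]
  all_goals
    have hs := hstep (by simp)
    subst hs
    by_cases hP : P <;> by_cases ho : o <;> cases v <;> simp [hP, ho, h20, h21]

open Classical in
/-- The partition function. -/
noncomputable def partition : ℝ :=
  ∑ σ : G → Fin 3, (∏ g, C.weight π g (σ g)) *
    (if ∀ g' g, C.Wire g' g → WireOK (C.type g') (C.type g) (σ g') (σ g) then 1 else 0)

-- Group the state assignments by the values they induce. Once all values are fixed, the wires into
-- `g` constrain only the state of `g`, so the sum over a group is a product of independent sums,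
-- one for each gate.
open Classical in
theorem partition_eq_sum_values :
    C.partition π = ∑ x : G → Bool,
      ∏ g, if g = C.output ∧ x g = false then 0 else C.localFactor π x g := by
  unfold partition
  rw [← Finset.sum_fiberwise (s := Finset.univ)
    (g := fun (σ : G → Fin 3) (g : G) => decide ((C.type g).Val (σ g)))]
  refine Finset.sum_congr rfl fun x _ => ?_
  simp_rw [← C.sum_states_eq π x]
  rw [Finset.prod_univ_sum]
  refine Finset.sum_congr ?_ fun σ hσ => ?_
  · ext σ
    simp [Fintype.mem_piFinset, funext_iff]
  · rw [Finset.prod_mul_distrib]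
    congr 1
    rw [Finset.prod_ite_zero]
    simp only [Finset.mem_univ, true_implies, Finset.prod_const_one]
    refine if_congr ?_ rfl rfl
    have hx : ∀ g, x g = true ↔ (C.type g).Val (σ g) := by
      intro g
      have := Fintype.mem_piFinset.1 hσ g
      simp only [Finset.mem_filter, Finset.mem_univ, true_and] at this
      rw [← this]; simp
    simp only [hx, WireOK]
    exact forall_comm

-- An assignment of values survives only if every non-variable gate is correct. It is then the
-- evaluation of its restriction to the variables, so the sum over values collapses to a sum over
-- valuations.
open Classical in
theorem prob_eq_partition : C.prob π = C.partition π := by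
  rw [partition_eq_sum_values]
  unfold prob
  symm
  -- If no gate were wrong, well-founded induction along the wires would identify `x` with the
  -- evaluation.
  have hzero : ∀ x : G → Bool, x ≠ C.eval (fun v => x v) →
      (∏ g, if g = C.output ∧ x g = false then 0 else C.localFactor π x g) = 0 := by
    intro x hx
    have : ∃ g, C.type g ≠ GateType.var ∧ x g ≠ C.step (fun v => x v) g (fun g' _ => x g') := by
      by_contra! hcon
      refine hx (funext fun g => ?_)
      induction g using C.wellFounded_wire.induction with
      | _ g ih =>
        rw [eval_eq]
        by_cases hg : C.type g = GateType.var
        · simp [step, hg]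
        · rw [hcon g hg]
          congr 1
          funext g' h
          exact ih g' h
    obtain ⟨g, h1, h2⟩ := this
    refine Finset.prod_eq_zero (Finset.mem_univ g) ?_
    simp [localFactor, h1, h2]
  -- The nonzero terms are matched by restriction to the variable gates; the inverse is `eval`.
  refine Finset.sum_bij_ne_zero (fun x _ _ => fun v : C.Var => x v) (fun _ _ _ => Finset.mem_univ _)
    ?_ ?_ ?_
  · intro x _ hx y _ hy h
    have hx' := not_imp_comm.1 (hzero x) hx
    have hy' := not_imp_comm.1 (hzero y) hy
    rw [hx', hy', h]
  · intro ν _ hν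
    have hv : (fun v : C.Var => C.eval ν v) = ν := by
      funext v; rw [eval_eq]; simp [step, v.2]
    refine ⟨C.eval ν, Finset.mem_univ _, ?_, hv⟩
    have : C.eval ν C.output = true := by
      by_contra h
      simp [h] at hν
    rw [if_pos this] at hν
    refine Finset.prod_ne_zero_iff.2 fun g _ => ?_
    rw [if_neg (by rintro ⟨rfl, h⟩; simp [this] at h)]
    unfold localFactor gateProb
    by_cases hg : C.type g = GateType.var
    · have := Finset.prod_ne_zero_iff.1 hν ⟨g, hg⟩ (Finset.mem_univ _)
      have e : C.eval ν g = ν ⟨g, hg⟩ := congrFun hv ⟨g, hg⟩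
      simpa [hg, e] using this
    · rw [if_neg hg, if_pos]
      · exact one_ne_zero
      · rw [hv, ← eval_eq]
  · intro x _ hx
    have hx' := not_imp_comm.1 (hzero x) hx
    have hout : x C.output = true := by
      by_contra h
      exact hx (Finset.prod_eq_zero (Finset.mem_univ C.output) (by simp [h]))
    rw [← hx', if_pos hout]
    have h1 : ∀ g, (if g = C.output ∧ x g = false then 0 else C.localFactor π x g) =
        if h : C.type g = GateType.var then
          (if x g = true then (π ⟨g, h⟩ : ℝ) else 1 - (π ⟨g, h⟩ : ℝ)) else 1 := by
      intro g
      rw [if_neg (by rintro ⟨rfl, h⟩; simp [hout] at h)]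
      unfold localFactor gateProb
      by_cases hg : C.type g = GateType.var
      · simp [hg]
      · have : x g = C.step (fun v => x v) g (fun g' _ => x g') := by
          conv_lhs => rw [hx', eval_eq, ← hx']
        simp [hg, ← this]
    rw [Finset.prod_congr rfl fun g _ => h1 g, Finset.prod_dite]
    simp only [Finset.prod_const_one, mul_one]
    refine Finset.prod_bij (fun a _ => ⟨a.1, (Finset.mem_filter.1 a.2).2⟩) (by simp) (by simp) ?_ ?_
    · rintro ⟨b, hb⟩ _
      exact ⟨⟨b, by simpa using hb⟩, by simp, rfl⟩
    · intro a _; rfl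

end Circuit

/-! ### Eliminating the bags of a tree decomposition one by one -/

section Elimination

variable {G S : Type} [Fintype G] [DecidableEq G] [Fintype S] [DecidableEq S] [Zero S]
  (bag : ℕ → Finset G) (w : G → S → ℝ) (ok : ℕ → (G → S) → ℝ)

/-- What the bag `c` sends to the bag `p`, if `F` is the table of `c`. -/
noncomputable def msg (c p : ℕ) (F : (G → S) → ℝ) (σ : G → S) : ℝ :=
  ∑ τ ∈ Finset.univ.filter fun τ : G → S =>
      (∀ g, g ∉ bag c → τ g = 0) ∧ ∀ g ∈ bag c, g ∈ bag p → τ g = σ g,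
    F τ * ((∏ g ∈ bag c \ bag p, w g (τ g)) * ok c τ)

/-- The partition function of the gates in the bags `R`. -/
noncomputable def partialSum (R : Finset ℕ) (F : ℕ → (G → S) → ℝ) : ℝ :=
  ∑ σ ∈ Finset.univ.filter fun σ : G → S => ∀ g, g ∉ R.biUnion bag → σ g = 0,
    (∏ g ∈ R.biUnion bag, w g (σ g)) * ∏ b ∈ R, (ok b σ * F b σ)

/-- The tables `F` after the bag `c` has sent its message to the bag `p`. -/
noncomputable def pass (c p : ℕ) (F : ℕ → (G → S) → ℝ) (b : ℕ) (σ : G → S) : ℝ :=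
  if b = p then F b σ * msg bag w ok c p (F c) σ else F b σ

/-- A message depends on `σ` only through the gates shared by the two bags, so tables remain
functions of the states within their own bags. -/
theorem pass_local {c p : ℕ} {F : ℕ → (G → S) → ℝ}
    (hF : ∀ b σ τ, (∀ g ∈ bag b, σ g = τ g) → F b σ = F b τ) (b : ℕ) (σ τ : G → S)
    (h : ∀ g ∈ bag b, σ g = τ g) : pass bag w ok c p F b σ = pass bag w ok c p F b τ := by
  unfold pass msg
  split_ifs with hb
  · subst hb
    rw [hF b σ τ h]
    congr 1
    refine Finset.sum_congr (Finset.filter_congr fun ρ _ => ?_) fun _ _ => rfl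
    refine and_congr_right fun _ => forall_congr' fun g => ?_
    exact ⟨fun h1 hc hb => (h1 hc hb).trans (h g hb),
      fun h1 hc hb => (h1 hc hb).trans (h g hb).symm⟩
  · exact hF b σ τ h

/-- One elimination step. By `hsep`, the gates of `c` outside `p` occur in no bag of `R`. A
configuration on all bags is therefore a configuration on `R` together with one on `c` that agrees
with it on the gates common to `c` and `p`. Everything that depends on the latter can be summed
first, and that sum is the message. -/
theorem partialSum_insert {R : Finset ℕ} {F : ℕ → (G → S) → ℝ} {c p : ℕ} (hc : c ∉ R)
    (hp : p ∈ R) (hsep : ∀ b ∈ R, ∀ g ∈ bag c, g ∈ bag b → g ∈ bag p)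
    (hF : ∀ b σ τ, (∀ g ∈ bag b, σ g = τ g) → F b σ = F b τ)
    (hok : ∀ b σ τ, (∀ g ∈ bag b, σ g = τ g) → ok b σ = ok b τ) :
    partialSum bag w ok (insert c R) F = partialSum bag w ok R (pass bag w ok c p F) := by
  have hU : (insert c R).biUnion bag = R.biUnion bag ∪ (bag c \ bag p) := by
    ext g
    simp only [Finset.biUnion_insert, Finset.mem_union, Finset.mem_sdiff, Finset.mem_biUnion]
    constructor
    · rintro (h | h)
      · by_cases hg : g ∈ bag p
        · exact Or.inl ⟨p, hp, hg⟩
        · exact Or.inr ⟨h, hg⟩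
      · exact Or.inl h
    · rintro (h | h)
      · exact Or.inr h
      · exact Or.inl h.1
  have hdisj : Disjoint (R.biUnion bag) (bag c \ bag p) := by
    rw [Finset.disjoint_left]
    intro g h1 h2
    obtain ⟨b, hb, hg⟩ := Finset.mem_biUnion.1 h1
    exact (Finset.mem_sdiff.1 h2).2 (hsep b hb g (Finset.mem_sdiff.1 h2).1 hg)
  have hprod : ∀ σ : G → S, ∏ b ∈ R, (ok b σ * pass bag w ok c p F b σ) =
      (∏ b ∈ R, (ok b σ * F b σ)) * msg bag w ok c p (F c) σ := by
    intro σ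
    rw [← Finset.mul_prod_erase R _ hp, ← Finset.mul_prod_erase R _ hp]
    have : ∀ b ∈ R.erase p, ok b σ * pass bag w ok c p F b σ = ok b σ * F b σ := by
      intro b hb
      simp [pass, (Finset.mem_erase.1 hb).1]
    rw [Finset.prod_congr rfl this]
    simp only [pass, if_true]
    ring
  unfold partialSum
  simp only [hprod]
  simp only [msg, Finset.mul_sum]
  rw [Finset.sum_sigma']
  -- Split `ρ` into its part on `R` and its part on `bag c`, each set to 0 elsewhere so that the
  -- pair is unique. To glue, take the second part on `bag c \ bag p` and the first part everywhere
  -- else.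
  refine Finset.sum_bij'
    (fun ρ _ => ⟨fun g => if g ∈ bag c \ bag p then 0 else ρ g,
      fun g => if g ∈ bag c then ρ g else 0⟩)
    (fun στ _ => fun g => if g ∈ bag c \ bag p then στ.2 g else στ.1 g) ?_ ?_ ?_ ?_ ?_
  · intro ρ hρ
    simp only [hU, Finset.mem_filter, Finset.mem_univ, true_and, Finset.mem_union, not_or] at hρ
    simp only [Finset.mem_sigma, Finset.mem_filter, Finset.mem_univ, true_and]
    refine ⟨fun g hg => ?_, fun g hg => by simp [hg], fun g h1 h2 => by simp [h1, h2]⟩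
    split_ifs with h
    · rfl
    · exact hρ g ⟨hg, h⟩
  · rintro ⟨σ, τ⟩ h
    simp only [Finset.mem_sigma, Finset.mem_filter, Finset.mem_univ, true_and] at h
    simp only [hU, Finset.mem_filter, Finset.mem_univ, true_and, Finset.mem_union, not_or]
    rintro g ⟨h1, h2⟩
    rw [if_neg h2, h.1 g h1]
  · intro ρ _
    funext g
    by_cases h1 : g ∈ bag c <;> by_cases h2 : g ∈ bag p <;> simp [h1, h2]
  · rintro ⟨σ, τ⟩ h
    simp only [Finset.mem_sigma, Finset.mem_filter, Finset.mem_univ, true_and] at h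
    obtain ⟨h1, h2, h3⟩ := h
    simp only [Sigma.mk.injEq, heq_eq_eq]
    constructor
    · funext g
      split_ifs with hg
      · exact (h1 g (Finset.disjoint_right.1 hdisj hg)).symm
      · rfl
    · funext g
      by_cases hgc : g ∈ bag c
      · by_cases hgp : g ∈ bag p
        · simp [hgc, hgp, h3 g hgc hgp]
        · simp [hgc, hgp]
      · simp [hgc, h2 g hgc]
  · intro ρ _
    simp only
    have e1 : ∀ b ∈ R, ∀ g ∈ bag b, ρ g = if g ∈ bag c \ bag p then 0 else ρ g := by
      intro b hb g hg
      rw [if_neg]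
      exact Finset.disjoint_left.1 hdisj (Finset.mem_biUnion.2 ⟨b, hb, hg⟩)
    have e2 : ∀ g ∈ bag c, ρ g = if g ∈ bag c then ρ g else 0 := fun g hg => by simp [hg]
    rw [hU, Finset.prod_union hdisj, Finset.prod_insert hc, ← hok c ρ _ e2, ← hF c ρ _ e2,
      Finset.prod_congr rfl (fun b hb => by rw [hok b ρ _ (e1 b hb), hF b ρ _ (e1 b hb)] :
        ∀ b ∈ R, ok b ρ * F b ρ = ok b (fun g => if g ∈ bag c \ bag p then 0 else ρ g) *
          F b fun g => if g ∈ bag c \ bag p then 0 else ρ g)]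
    have e3 : ∏ g ∈ R.biUnion bag, w g (ρ g) =
        ∏ g ∈ R.biUnion bag, w g (if g ∈ bag c \ bag p then 0 else ρ g) :=
      Finset.prod_congr rfl fun g hg => by rw [if_neg (Finset.disjoint_left.1 hdisj hg)]
    have e4 : ∏ g ∈ bag c \ bag p, w g (ρ g) =
        ∏ g ∈ bag c \ bag p, w g (if g ∈ bag c then ρ g else 0) :=
      Finset.prod_congr rfl fun g hg => by rw [if_pos (Finset.mem_sdiff.1 hg).1]
    rw [e3, e4]
    ring

/-- The tables after the bags `Q 0, …, Q (t - 1)` have sent their messages. -/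
noncomputable def tables (par Q : ℕ → ℕ) : ℕ → ℕ → (G → S) → ℝ
  | 0 => fun _ _ => 1
  | t + 1 => pass bag w ok (Q t) (par (Q t)) (tables par Q t)

/-- The nodes `Q 0, …, Q (m - 1)` are `0, …, m - 1`, and each comes before its parent,
unless the parent is `m`. -/
structure IsOrder (m : ℕ) (par Q : ℕ → ℕ) : Prop where
  lt : ∀ t < m, Q t < m
  inj : ∀ t < m, ∀ t' < m, Q t = Q t' → t = t'
  parent : ∀ t < m, par (Q t) = m ∨ ∃ t', t < t' ∧ t' < m ∧ Q t' = par (Q t)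

theorem IsOrder.surj {m : ℕ} {par Q : ℕ → ℕ} (h : IsOrder m par Q) {b : ℕ} (hb : b < m) :
    ∃ t < m, Q t = b := by
  have h1 : Function.Injective fun t : Fin m => (⟨Q t, h.lt t t.2⟩ : Fin m) := fun t t' e =>
    Fin.ext (h.inj t t.2 t' t'.2 (Fin.mk.inj_iff.1 e))
  obtain ⟨t, ht⟩ := (Finite.injective_iff_surjective.1 h1) ⟨b, hb⟩
  exact ⟨t, t.2, Fin.mk.inj_iff.1 ht⟩

/-- The tables of a tree decomposition with the virtual root `m` give the partition function. -/
theorem tables_root {m : ℕ} {par Q : ℕ → ℕ} (hQ : IsOrder m par Q) (hm : bag m = ∅)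
    (hsep : ∀ t < m, ∀ t', t < t' → t' < m → ∀ g ∈ bag (Q t), g ∈ bag (Q t') →
      g ∈ bag (par (Q t)))
    (hcov : ∀ g, ∃ b < m, g ∈ bag b)
    (hok : ∀ b σ τ, (∀ g ∈ bag b, σ g = τ g) → ok b σ = ok b τ) (hokm : ∀ σ, ok m σ = 1) :
    tables bag w ok par Q m m 0 = ∑ σ : G → S, (∏ g, w g (σ g)) *
      ∏ b ∈ Finset.range m, ok b σ := by
  have hloc : ∀ t b (σ τ : G → S), (∀ g ∈ bag b, σ g = τ g) →
      tables bag w ok par Q t b σ = tables bag w ok par Q t b τ := by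
    intro t
    induction t with
    | zero => intros; rfl
    | succ t ih => exact pass_local bag w ok ih
  -- The partial sum over the unprocessed nodes and `m` is the same for every `t`. For `t = 0` it is
  -- the whole partition function; for `t = m` only the empty bag is left and the sum has a single
  -- term.
  have hstep : ∀ t ≤ m, partialSum bag w ok (insert m ((Finset.Ico t m).image Q))
      (tables bag w ok par Q t) = partialSum bag w ok (insert m ((Finset.Ico 0 m).image Q))
      (tables bag w ok par Q 0) := by
    intro t
    induction t with
    | zero => intro _; rfl
    | succ t ih =>
      intro ht
      rw [← ih (by omega)]
      have e : insert m ((Finset.Ico t m).image Q) =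
          insert (Q t) (insert m ((Finset.Ico (t + 1) m).image Q)) := by
        rw [Finset.insert_comm, ← Finset.image_insert, Finset.insert_Ico_add_one_left_eq_Ico ht]
      rw [e, partialSum_insert bag w ok (p := par (Q t)) ?_ ?_ ?_ (hloc t) hok]
      · rfl
      · simp only [Finset.mem_insert, Finset.mem_image, Finset.mem_Ico, not_or, not_exists]
        refine ⟨(hQ.lt t ht).ne, ?_⟩
        rintro t' ⟨h1, h2⟩
        have := hQ.inj t' h1.2 t ht h2
        omega
      · rcases hQ.parent t ht with h | ⟨t', h1, h2, h3⟩
        · simp [h]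
        · rw [← h3]
          exact Finset.mem_insert_of_mem (Finset.mem_image_of_mem _ (by simp; omega))
      · intro b hb g hgc hgb
        rcases Finset.mem_insert.1 hb with rfl | hb
        · simp [hm] at hgb
        · obtain ⟨t', ht', rfl⟩ := Finset.mem_image.1 hb
          simp only [Finset.mem_Ico] at ht'
          exact hsep t ht t' (by omega) ht'.2 g hgc hgb
  have himg : (Finset.Ico 0 m).image Q = Finset.range m := by
    ext b
    simp only [Finset.mem_image, Finset.mem_Ico, Finset.mem_range]
    constructor
    · rintro ⟨t, ht, rfl⟩; exact hQ.lt t ht.2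
    · intro hb
      obtain ⟨t, ht, rfl⟩ := hQ.surj hb
      exact ⟨t, ⟨by omega, ht⟩, rfl⟩
  have h := hstep m le_rfl
  rw [himg] at h
  have hU : (insert m (Finset.range m)).biUnion bag = Finset.univ := by
    ext g
    obtain ⟨b, hb, hg⟩ := hcov g
    simp only [Finset.mem_biUnion, Finset.mem_univ, iff_true]
    exact ⟨b, Finset.mem_insert_of_mem (Finset.mem_range.2 hb), hg⟩
  have hfil : (Finset.univ.filter fun σ : G → S => ∀ g, σ g = 0) = {0} := by
    ext σ; simp [funext_iff]
  unfold partialSum at h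
  simp only [hU, Finset.Ico_self, Finset.image_empty, Finset.insert_empty,
    Finset.singleton_biUnion, hm, Finset.notMem_empty, not_false_eq_true, true_implies, hfil,
    Finset.sum_singleton, Finset.prod_empty, one_mul, Finset.prod_singleton, hokm,
    Finset.mem_univ, not_true_eq_false, false_implies, implies_true,
    Finset.filter_true] at h
  rw [h]
  refine Finset.sum_congr rfl fun σ _ => ?_
  rw [Finset.prod_insert (by simp), hokm]
  simp [tables]

end Elimination

/-! ### The tree with a virtual root -/

section Nodes

variable {n m : ℕ} {C : Circuit (Fin n)} (T : TreeDecomposition C (Fin m))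
  (bl : Fin m → List (Fin n))

/-- The parent; the parent of the root is the virtual node `m`. -/
def nodeParent (b : ℕ) : ℕ :=
  if h : b < m then if ⟨b, h⟩ = T.root then m else T.parent ⟨b, h⟩ else m

/-- The bag of a node; the virtual node has an empty bag. -/
def nodeBag (b : ℕ) : List (Fin n) := if h : b < m then bl ⟨b, h⟩ else []

theorem nodeParent_le (b : ℕ) : nodeParent T b ≤ m := by
  unfold nodeParent
  split_ifs
  · exact le_rfl
  · exact (Fin.isLt _).le
  · exact le_rfl

theorem nodeParent_iterate (j : ℕ) (b : Fin m) (h : T.parent^[j] b = T.root) :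
    ∃ j, (nodeParent T)^[j] b = m := by
  induction j generalizing b with
  | zero =>
    refine ⟨1, ?_⟩
    have : b = T.root := h
    simp [nodeParent, this]
  | succ j ih =>
    obtain ⟨i, hi⟩ := ih (T.parent b) h
    by_cases hb : b = T.root
    · exact ⟨1, by simp [nodeParent, hb]⟩
    · refine ⟨i + 1, ?_⟩
      rw [Function.iterate_succ_apply]
      have : nodeParent T b = T.parent b := by simp [nodeParent, hb]
      rw [this, hi]

/-- The depth is the number of steps to the virtual node, finite because every node reaches the
root. It serves as the measure showing that the queue never stalls, and that a node differs from its
parent. -/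
theorem exists_depth : ∃ dep : ℕ → ℕ, ∀ b < m, dep b = dep (nodeParent T b) + 1 := by
  classical
  have h : ∀ b, ∃ j, (nodeParent T)^[j] b = m := by
    intro b
    by_cases hb : b < m
    · obtain ⟨j, hj⟩ := T.reach_root ⟨b, hb⟩
      exact nodeParent_iterate T j _ hj
    · exact ⟨1, by simp [nodeParent, hb]⟩
  refine ⟨fun b => Nat.find (h b), fun b hb => ?_⟩
  show Nat.find (h b) = Nat.find (h (nodeParent T b)) + 1
  refine (Nat.find_eq_iff _).2 ⟨?_, fun j hj => ?_⟩
  · exact Nat.find_spec (h (nodeParent T b))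
  · cases j with
    | zero => exact hb.ne
    | succ j => exact Nat.find_min (h (nodeParent T b)) (by omega)

variable {T bl}

theorem mem_nodeBag (hbl : T.ListsBags bl) (b : Fin m) (g : Fin n) :
    g ∈ nodeBag bl b ↔ g ∈ T.bag b := by
  simp [nodeBag, (hbl b).2 g]

theorem nodeBag_nodup (hbl : T.ListsBags bl) (b : ℕ) : (nodeBag bl b).Nodup := by
  unfold nodeBag
  split_ifs with h
  · exact (hbl _).1
  · exact List.nodup_nil

theorem nodeBag_length_le (hbl : T.ListsBags bl) (b : ℕ) :
    (nodeBag bl b).length ≤ T.width + 1 := by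
  unfold nodeBag
  split_ifs with h
  · have h1 : (bl ⟨b, h⟩).length = (T.bag ⟨b, h⟩).card := by
      rw [← List.toFinset_card_of_nodup (hbl _).1]
      congr 1
      ext g
      simp [(hbl _).2 g]
    have h2 := Finset.le_sup (f := fun b => (T.bag b).card) (Finset.mem_univ (⟨b, h⟩ : Fin m))
    unfold TreeDecomposition.width
    omega
  · simp

theorem exists_mem_nodeBag (hbl : T.ListsBags bl) (g : Fin n) : ∃ b < m, g ∈ nodeBag bl b := by
  obtain ⟨⟨b, hb⟩⟩ := (T.connected g).nonempty
  exact ⟨b, b.2, (mem_nodeBag hbl b g).2 hb⟩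

/-- The nodes containing `g` are connected, so a walk among them leads from `Q t` to `Q t'`. The
latter comes later in the order and is thus not a descendant of `Q t`. The walk must leave the
subtree below `Q t`, which is possible only through the edge to the parent. -/
theorem mem_nodeBag_parent (hbl : T.ListsBags bl) {Q : ℕ → ℕ} (hQ : IsOrder m (nodeParent T) Q)
    {t t' : ℕ} (ht : t < m) (htt' : t < t') (ht' : t' < m) {g : Fin n}
    (hg : g ∈ nodeBag bl (Q t)) (hg' : g ∈ nodeBag bl (Q t')) :
    g ∈ nodeBag bl (nodeParent T (Q t)) := by
  set c : Fin m := ⟨Q t, hQ.lt t ht⟩ with hc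
  set b : Fin m := ⟨Q t', hQ.lt t' ht'⟩ with hb
  -- Descendants of `c` come no later than `c` in the order.
  have hdesc : ∀ j (b : Fin m) (i : ℕ), i < m → Q i = b → T.parent^[j] b = c → i ≤ t := by
    intro j
    induction j with
    | zero =>
      intro b i hi hib h
      have : b = c := h
      rw [this] at hib
      exact (hQ.inj i hi t ht hib).le
    | succ j ih =>
      intro b i hi hib h
      rw [Function.iterate_succ_apply] at h
      by_cases hr : b = T.root
      · rw [hr, T.parent_root, ← hr] at h
        exact ih b i hi hib h
      · have hp : nodeParent T (Q i) = T.parent b := by rw [hib]; simp [nodeParent, hr]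
        rcases hQ.parent i hi with h1 | ⟨i', h1, h2, h3⟩
        · rw [hp] at h1
          exact absurd h1 (Fin.isLt _).ne
        · exact h1.le.trans (ih (T.parent b) i' h2 (h3.trans hp) h)
  obtain ⟨walk⟩ := (T.connected g).preconnected ⟨c, (mem_nodeBag hbl c g).1 hg⟩
    ⟨b, (mem_nodeBag hbl b g).1 hg'⟩
  -- An edge of the walk that leaves the set of descendants of `c`.
  obtain ⟨d, _, h1, h2⟩ := walk.exists_boundary_dart
    {x | ∃ j, T.parent^[j] x.1 = c} ⟨0, rfl⟩
    (by rintro ⟨j, hj⟩; have := hdesc j b t' ht' rfl hj; omega)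
  obtain ⟨⟨⟨u, hu⟩, ⟨v, hv⟩⟩, hadj⟩ := d
  simp only [Set.mem_ofPred_eq] at h1 h2
  simp only [SimpleGraph.comap_adj, SimpleGraph.fromRel_adj, Function.Embedding.subtype_apply]
    at hadj
  obtain ⟨j, hj⟩ := h1
  -- If the edge goes up from a proper descendant, its end is still a descendant, so it starts at
  -- `c`. If it goes down, its end is a descendant as well.
  rcases hadj with ⟨hne, h | h⟩
  · cases j with
    | zero =>
      have huc : u = c := hj
      have hr : u ≠ T.root := by
        rintro rfl
        exact hne (by rw [← h, T.parent_root])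
      have hp : nodeParent T (Q t) = v := by
        have : Q t = u := by rw [huc]
        rw [this]
        simp [nodeParent, hr, h]
      rw [hp]
      exact (mem_nodeBag hbl v g).2 hv
    | succ j =>
      rw [Function.iterate_succ_apply, h] at hj
      exact absurd ⟨j, hj⟩ h2
  · exact absurd ⟨j + 1, by rw [Function.iterate_succ_apply, h]; exact hj⟩ h2

end Nodes

/-! ### The partition function as the root table of a tree decomposition -/

section

open Classical

variable {n m : ℕ} (C : Circuit (Fin n)) (bl : Fin m → List (Fin n))

/-- Whether the wires within the bag `b` are respected. -/
noncomputable def bagOK (b : ℕ) (σ : Fin n → Fin 3) : ℝ :=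
  ∏ g ∈ (nodeBag bl b).toFinset, ∏ g' ∈ (nodeBag bl b).toFinset,
    if C.Wire g' g ∧ ¬ WireOK (C.type g') (C.type g) (σ g') (σ g) then 0 else 1

/-- The tables that the machine computes. -/
noncomputable def nodeTables (T : TreeDecomposition C (Fin m)) (π : C.Var → unitInterval)
    (Q : ℕ → ℕ) : ℕ → ℕ → (Fin n → Fin 3) → ℝ :=
  tables (fun b => (nodeBag bl b).toFinset) (C.weight π) (bagOK C bl) (nodeParent T) Q

/-- Every wire is tested in at least one bag, by `wire_covered`. Being tested in several does no
harm since the factors are 0 or 1. -/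
theorem nodeTables_root {T : TreeDecomposition C (Fin m)} (π : C.Var → unitInterval)
    (hbl : T.ListsBags bl) {Q : ℕ → ℕ} (hQ : IsOrder m (nodeParent T) Q) :
    nodeTables C bl T π Q m m 0 = C.prob π := by
  rw [C.prob_eq_partition π, nodeTables,
    tables_root (fun b => (nodeBag bl b).toFinset) (C.weight π) (bagOK C bl) hQ]
  · unfold Circuit.partition
    refine Finset.sum_congr rfl fun σ _ => ?_
    congr 1
    unfold bagOK
    by_cases h : ∀ g' g, C.Wire g' g → WireOK (C.type g') (C.type g) (σ g') (σ g)
    · rw [if_pos h]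
      refine Finset.prod_eq_one fun b _ => Finset.prod_eq_one fun g _ =>
        Finset.prod_eq_one fun g' _ => if_neg ?_
      rintro ⟨h1, h2⟩
      exact h2 (h g' g h1)
    · rw [if_neg h]
      push Not at h
      obtain ⟨g', g, h1, h2⟩ := h
      obtain ⟨b, hb', hb⟩ := T.wire_covered g' g h1
      refine Finset.prod_eq_zero (Finset.mem_range.2 b.2) ?_
      refine Finset.prod_eq_zero (i := g) ?_ ?_
      · simpa using (mem_nodeBag hbl b g).2 hb
      refine Finset.prod_eq_zero (i := g') ?_ ?_
      · simpa using (mem_nodeBag hbl b g').2 hb'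
      exact if_pos ⟨h1, h2⟩
  · simp [nodeBag]
  · intro t ht t' htt' ht' g hg hg'
    simp only [List.mem_toFinset] at *
    exact mem_nodeBag_parent hbl hQ ht htt' ht' hg hg'
  · intro g
    obtain ⟨b, hb, hg⟩ := exists_mem_nodeBag hbl g
    exact ⟨b, hb, by simpa using hg⟩
  · intro b σ τ h
    unfold bagOK
    refine Finset.prod_congr rfl fun g hg => Finset.prod_congr rfl fun g' hg' => ?_
    rw [h g hg, h g' hg']
  · intro σ
    simp [bagOK, nodeBag]

end

/-! ### Base-three encoding of the states of a bag -/

section Decode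

variable {n : ℕ}

/-- The states that the number `i` gives to the gates in the list `l`. -/
def decode (l : List (Fin n)) (i : ℕ) (g : Fin n) : Fin 3 :=
  if g ∈ l then ⟨i / 3 ^ l.idxOf g % 3, Nat.mod_lt _ (by norm_num)⟩ else 0

theorem decode_getElem {l : List (Fin n)} (hl : l.Nodup) (i : ℕ) {q : ℕ} (hq : q < l.length) :
    (decode l i l[q] : ℕ) = i / 3 ^ q % 3 := by
  rw [decode, if_pos (List.getElem_mem hq)]
  simp [hl.idxOf_getElem q hq]

/-- The base-three digits of `i` are the states along `l`; this is `finFunctionFinEquiv`, extended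
by 0 outside `l`. -/
theorem sum_decode {l : List (Fin n)} (hl : l.Nodup) (F : (Fin n → Fin 3) → ℝ) :
    ∑ i ∈ Finset.range (3 ^ l.length), F (decode l i) =
      ∑ σ ∈ Finset.univ.filter (fun σ : Fin n → Fin 3 => ∀ g, g ∉ l → σ g = 0), F σ := by
  have hdec : ∀ (i : Fin (3 ^ l.length)) (q : Fin l.length),
      finFunctionFinEquiv.symm i q = decode l i l[q] := by
    intro i q
    apply Fin.ext
    rw [Fin.getElem_fin, decode_getElem hl]
    rfl
  refine Finset.sum_bij (fun i _ => decode l i) ?_ ?_ ?_ (fun _ _ => rfl)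
  · intro i _
    simp only [Finset.mem_filter, Finset.mem_univ, true_and]
    intro g hg
    simp [decode, hg]
  · intro i hi j hj h
    rw [Finset.mem_range] at hi hj
    have : (⟨i, hi⟩ : Fin (3 ^ l.length)) = ⟨j, hj⟩ := by
      apply finFunctionFinEquiv.symm.injective
      funext q
      rw [hdec, hdec]
      exact congrFun h _
    exact Fin.mk.inj_iff.1 this
  · intro σ hσ
    simp only [Finset.mem_filter, Finset.mem_univ, true_and] at hσ
    set i : Fin (3 ^ l.length) := finFunctionFinEquiv fun q : Fin l.length => σ l[q] with hi
    refine ⟨i, Finset.mem_range.2 i.2, ?_⟩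
    funext g
    by_cases hg : g ∈ l
    · obtain ⟨q, hq, rfl⟩ := List.getElem_of_mem hg
      have := hdec i ⟨q, hq⟩
      rw [hi, Equiv.symm_apply_apply] at this
      exact this.symm
    · rw [hσ g hg]; simp [decode, hg]

end Decode

/-! ### Sorting the nodes: children first -/

/-- The invariant of the sorting algorithm: `Q 0, …, Q (tail - 1)` is the queue, of which `t`
elements have been processed, and `cnt b` is the number of unprocessed children of `b`. -/
structure QueueInv (m t tail : ℕ) (par cnt Q : ℕ → ℕ) : Prop where
  le : t ≤ tail
  cnt_eq : ∀ b ≤ m,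
    cnt b = ((Finset.range m).filter fun c => par c = b ∧ ∀ i < t, Q i ≠ c).card
  mem_le : ∀ j < tail, Q j ≤ m
  lt : ∀ j < t, Q j < m
  inj : ∀ j < tail, ∀ j' < tail, Q j = Q j' → j = j'
  zero_iff : ∀ b ≤ m, cnt b = 0 ↔ ∃ j < tail, Q j = b
  child : ∀ j < tail, ∀ c < m, par c = Q j → ∃ i < j, Q i = c

namespace QueueInv

variable {m t tail : ℕ} {par cnt Q : ℕ → ℕ}

/-- Pigeonhole: the queue holds distinct numbers up to `m`. -/
theorem tail_le (h : QueueInv m t tail par cnt Q) : tail ≤ m + 1 := by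
  have := Finset.card_le_card_of_injOn (s := Finset.range tail) (t := Finset.range (m + 1)) Q
    (fun j hj => by
      have := h.mem_le j (Finset.mem_range.1 hj)
      exact Finset.mem_coe.2 (Finset.mem_range.2 (by omega)))
    (fun j hj j' hj' e => h.inj j (by simpa using hj) j' (by simpa using hj') e)
  simpa using this

/-- The queue neither runs dry nor reaches the virtual node before all `m` nodes are processed. -/
theorem next (h : QueueInv m t tail par cnt Q) (ht : t < m) {dep : ℕ → ℕ}
    (hdep : ∀ b < m, dep b = dep (par b) + 1) (hpar : ∀ b < m, par b ≤ m) :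
    t < tail ∧ Q t < m := by
  classical
  set S := (Finset.range m).filter fun c => ∀ i < t, Q i ≠ c with hS
  have hne : S.Nonempty := by
    by_contra hcon
    rw [Finset.not_nonempty_iff_eq_empty] at hcon
    have : Finset.range m ⊆ (Finset.range t).image Q := by
      intro c hc
      by_contra hc'
      have : c ∈ S := by
        simp only [hS, Finset.mem_filter]
        refine ⟨hc, fun i hi e => hc' ?_⟩
        exact Finset.mem_image.2 ⟨i, Finset.mem_range.2 hi, e⟩
      simp [hcon] at this
    have := (Finset.card_le_card this).trans Finset.card_image_le
    simp at this
    omega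
  have hmem : ∀ c, c ∈ S ↔ c < m ∧ ∀ i < t, Q i ≠ c := by intro c; simp [hS]
  have h1 : t < tail := by
    -- A deepest unprocessed node has no unprocessed child. It is therefore in the queue, at
    -- position `t` or later.
    obtain ⟨b, hb, hmax⟩ := Finset.exists_max_image S dep hne
    have hbm := (hmem b).1 hb
    have h0 : cnt b = 0 := by
      rw [h.cnt_eq b hbm.1.le, Finset.card_eq_zero, Finset.filter_eq_empty_iff]
      rintro c hc ⟨e1, e2⟩
      have h3 := hmax c ((hmem c).2 ⟨Finset.mem_range.1 hc, e2⟩)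
      have h4 := hdep c (Finset.mem_range.1 hc)
      rw [e1] at h4
      omega
    obtain ⟨j, hj, e⟩ := (h.zero_iff b hbm.1.le).1 h0
    by_contra hcon
    exact hbm.2 j (by omega) e
  refine ⟨h1, lt_of_le_of_ne (h.mem_le t h1) fun he => ?_⟩
  -- Suppose the virtual node were next. The parent of a shallowest unprocessed node is processed or
  -- virtual, so it sits at a position up to `t`. Children precede parents in the queue, so that
  -- node would have been processed already.
  obtain ⟨b, hb, hmin⟩ := Finset.exists_min_image S dep hne
  have hbm := (hmem b).1 hb
  have h2 : ∃ j ≤ t, Q j = par b := by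
    by_cases hpm : par b = m
    · exact ⟨t, le_rfl, he.trans hpm.symm⟩
    · by_contra hcon
      push Not at hcon
      have h3 := hmin (par b) ((hmem _).2
        ⟨lt_of_le_of_ne (hpar b hbm.1) hpm, fun i hi => hcon i hi.le⟩)
      have h4 := hdep b hbm.1
      omega
  obtain ⟨j, hj, e⟩ := h2
  obtain ⟨i, hi, e'⟩ := h.child j (by omega) b hbm.1 e.symm
  exact hbm.2 i (by omega) e'

/-- Processing the next node of the queue. -/
theorem step (h : QueueInv m t tail par cnt Q) (h1 : t < tail) (h2 : Q t < m)
    (hpar : par (Q t) ≤ m) {cnt' Q' : ℕ → ℕ} {tail' : ℕ}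
    (hcnt' : cnt' = Function.update cnt (par (Q t)) (cnt (par (Q t)) - 1))
    (hz : cnt (par (Q t)) - 1 = 0 → tail' = tail + 1 ∧ Q' = Function.update Q tail (par (Q t)))
    (hnz : cnt (par (Q t)) - 1 ≠ 0 → tail' = tail ∧ Q' = Q) :
    QueueInv m (t + 1) tail' par cnt' Q' := by
  classical
  set p := par (Q t) with hp
  have hQ' : ∀ j < tail, Q' j = Q j := by
    intro j hj
    by_cases h0 : cnt p - 1 = 0
    · rw [(hz h0).2, Function.update_of_ne hj.ne]
    · rw [(hnz h0).2]
  have htail : tail ≤ tail' := by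
    by_cases h0 : cnt p - 1 = 0
    · have := (hz h0).1; omega
    · have := (hnz h0).1; omega
  have hfil : ∀ b, (Finset.range m).filter (fun c => par c = b ∧ ∀ i < t + 1, Q' i ≠ c) =
      ((Finset.range m).filter fun c => par c = b ∧ ∀ i < t, Q i ≠ c).erase (Q t) := by
    intro b
    ext c
    simp only [Finset.mem_filter, Finset.mem_erase, Finset.mem_range]
    constructor
    · rintro ⟨e1, e2, e3⟩
      refine ⟨fun e => e3 t (by omega) ((hQ' t h1).trans e.symm), e1, e2, fun i hi e => ?_⟩
      exact e3 i (by omega) ((hQ' i (by omega)).trans e)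
    · rintro ⟨e0, e1, e2, e3⟩
      refine ⟨e1, e2, fun i hi e => ?_⟩
      rw [hQ' i (by omega)] at e
      rcases Nat.lt_succ_iff_lt_or_eq.1 hi with hi | rfl
      · exact e3 i hi e
      · exact e0 e.symm
  have hmem : Q t ∈ (Finset.range m).filter fun c => par c = p ∧ ∀ i < t, Q i ≠ c := by
    simp only [Finset.mem_filter, Finset.mem_range]
    refine ⟨h2, rfl, fun i hi e => ?_⟩
    have := h.inj i (by omega) t h1 e
    omega
  have hpos : cnt p ≠ 0 := by
    rw [h.cnt_eq p hpar]
    exact (Finset.card_pos.2 ⟨_, hmem⟩).ne'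
  -- The parent still has the unprocessed child `Q t`, so it has not been queued before and is never
  -- queued twice.
  have hpQ : ∀ j < tail, Q j ≠ p := fun j hj e => hpos ((h.zero_iff p hpar).2 ⟨j, hj, e⟩)
  have hcnt : ∀ b ≤ m,
      cnt' b = ((Finset.range m).filter fun c => par c = b ∧ ∀ i < t + 1, Q' i ≠ c).card := by
    intro b hb
    rw [hfil, hcnt']
    by_cases e : b = p
    · subst e
      rw [Function.update_self, Finset.card_erase_of_mem hmem, h.cnt_eq _ hpar]
    · rw [Function.update_of_ne e, Finset.erase_eq_of_notMem, h.cnt_eq b hb]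
      simp only [Finset.mem_filter, not_and]
      intro _ e'
      exact absurd e'.symm e
  -- When the count of `p` drops to zero, all its children have been processed, which is what
  -- `child` requires of the newly queued `p`.
  have hchild : ∀ c < m, par c = p → cnt p - 1 = 0 → ∃ i < t + 1, Q' i = c := by
    intro c hc hcp h0
    have h3 := hcnt p hpar
    rw [hcnt', Function.update_self, h0] at h3
    have h4 := Finset.filter_eq_empty_iff.1 (Finset.card_eq_zero.1 h3.symm)
      (Finset.mem_range.2 hc)
    by_contra hcon
    push Not at hcon
    exact h4 ⟨hcp, hcon⟩
  refine ⟨by omega, hcnt, ?_, ?_, ?_, ?_, ?_⟩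
  · intro j hj
    by_cases hjt : j < tail
    · rw [hQ' j hjt]; exact h.mem_le j hjt
    · by_cases h0 : cnt p - 1 = 0
      · obtain ⟨e1, e2⟩ := hz h0
        have : j = tail := by omega
        rw [this, e2, Function.update_self]; exact hpar
      · have := (hnz h0).1; omega
  · intro j hj
    rw [hQ' j (by omega)]
    rcases Nat.lt_succ_iff_lt_or_eq.1 hj with hj | rfl
    · exact h.lt j hj
    · exact h2
  · intro j hj j' hj' e
    by_cases h0 : cnt p - 1 = 0
    · obtain ⟨e1, e2⟩ := hz h0
      rcases Nat.lt_or_ge j tail with a | a <;> rcases Nat.lt_or_ge j' tail with a' | a'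
      · rw [hQ' j a, hQ' j' a'] at e; exact h.inj j a j' a' e
      · have : j' = tail := by omega
        rw [hQ' j a, this, e2, Function.update_self] at e
        exact absurd e (hpQ j a)
      · have : j = tail := by omega
        rw [hQ' j' a', this, e2, Function.update_self] at e
        exact absurd e.symm (hpQ j' a')
      · omega
    · have := (hnz h0).1
      rw [hQ' j (by omega), hQ' j' (by omega)] at e
      exact h.inj j (by omega) j' (by omega) e
  · intro b hb
    rw [hcnt']
    by_cases e : b = p
    · subst e
      rw [Function.update_self]
      constructor
      · intro h0
        obtain ⟨e1, e2⟩ := hz h0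
        exact ⟨tail, by omega, by rw [e2, Function.update_self]⟩
      · rintro ⟨j, hj, e⟩
        by_contra h0
        obtain ⟨e1, e2⟩ := hnz h0
        rw [e2] at e
        exact hpQ j (by omega) e
    · rw [Function.update_of_ne e, h.zero_iff b hb]
      constructor
      · rintro ⟨j, hj, e'⟩
        exact ⟨j, by omega, (hQ' j hj).trans e'⟩
      · rintro ⟨j, hj, e'⟩
        by_cases hjt : j < tail
        · exact ⟨j, hjt, (hQ' j hjt).symm.trans e'⟩
        · by_cases h0 : cnt p - 1 = 0
          · obtain ⟨e1, e2⟩ := hz h0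
            have : j = tail := by omega
            rw [this, e2, Function.update_self] at e'
            exact absurd e'.symm e
          · have := (hnz h0).1; omega
  · intro j hj c hc hcj
    by_cases hjt : j < tail
    · rw [hQ' j hjt] at hcj
      obtain ⟨i, hi, e⟩ := h.child j hjt c hc hcj
      exact ⟨i, hi, (hQ' i (by omega)).trans e⟩
    · by_cases h0 : cnt p - 1 = 0
      · obtain ⟨e1, e2⟩ := hz h0
        have : j = tail := by omega
        rw [this, e2, Function.update_self] at hcj
        obtain ⟨i, hi, e⟩ := hchild c hc hcj h0
        exact ⟨i, by omega, e⟩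
      · have := (hnz h0).1; omega

/-- The first `m` entries exhaust the nodes, so a non-virtual parent occurs among them, and `child`
puts it after each of its children. -/
theorem isOrder (h : QueueInv m m tail par cnt Q) (hpar : ∀ b < m, par b ≤ m) :
    IsOrder m par Q := by
  have hle := h.le
  have hinj : ∀ t < m, ∀ t' < m, Q t = Q t' → t = t' :=
    fun t ht t' ht' => h.inj t (by omega) t' (by omega)
  refine ⟨h.lt, hinj, fun t ht => ?_⟩
  by_cases hm : par (Q t) = m
  · exact Or.inl hm
  · have hlt : par (Q t) < m := lt_of_le_of_ne (hpar _ (h.lt t ht)) hm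
    have h1 : Function.Injective fun t : Fin m => (⟨Q t, h.lt t t.2⟩ : Fin m) := fun t t' e =>
      Fin.ext (hinj t t.2 t' t'.2 (Fin.mk.inj_iff.1 e))
    obtain ⟨⟨t', ht'⟩, e⟩ := (Finite.injective_iff_surjective.1 h1) ⟨_, hlt⟩
    have e := Fin.mk.inj_iff.1 e
    obtain ⟨i, hi, e'⟩ := h.child t' (by omega) (Q t) (h.lt t ht) e.symm
    have := hinj i (by omega) t ht e'
    exact Or.inr ⟨t', by omega, ht', e⟩

end QueueInv

/-! ### Pairs as indices of one-dimensional arrays -/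

theorem mul_add_inj {n a b c d : ℕ} (hb : b < n) (hd : d < n) (h : a * n + b = c * n + d) :
    a = c ∧ b = d := by
  have h1 : a = c := by
    have e := congrArg (· / n) h
    simpa [Nat.add_div_of_dvd_right, Nat.mul_div_cancel _ (Nat.zero_lt_of_lt hb),
      Nat.div_eq_of_lt hb, Nat.div_eq_of_lt hd, Nat.add_comm (_ * n),
      Nat.add_mul_div_right _ _ (Nat.zero_lt_of_lt hb)] using e
  subst h1
  exact ⟨rfl, by omega⟩

theorem mul_add_lt {n a b c : ℕ} (ha : a < c) (hb : b < n) : a * n + b < c * n := by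
  calc a * n + b < a * n + n := by omega
    _ = (a + 1) * n := by ring
    _ ≤ c * n := Nat.mul_le_mul_right n ha

/-! ### The adjacency matrix -/

/-- Write the adjacency matrix into the array 6. -/
def adjProg : Prog :=
  .seq (.iset 6 (.lit 0)) (forLoop 6 2
    (.iput 6 (.add (.mul (.get 1 (.var 6)) (.var 0)) (.get 2 (.var 6))) (.lit 1)))

/-- The matrix has `n * n` cells, but only those of the wires are written; the others are zero from
the start. The time is linear in the number of wires. -/
theorem run_adjProg {W n : ℕ} {s : Store} {ws : List (Fin n × Fin n)} (h0 : s.ivar 0 = n)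
    (h2 : s.ivar 2 = ws.length) (hsrc : ∀ j (h : j < ws.length), s.iarr 1 j = ws[j].1)
    (htgt : ∀ j (h : j < ws.length), s.iarr 2 j = ws[j].2) (hz : ∀ i, s.iarr 6 i = 0)
    (hnW : n < W) (hnnW : n * n < W) (hwW : ws.length < W) (h1W : 1 < W) :
    Run W adjProg s (ws.length * 17 + 6) fun s' =>
      ∀ g' g : Fin n, s'.iarr 6 (g' * n + g) = if (g', g) ∈ ws then 1 else 0 := by
  refine Run.mono (Run.seq_wp (Run.iset (by simp [IExp.Fits]; omega)
    (Run.forLoop (lo := 0) (N := ws.length) (tb := 9) (fun j s' =>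
      ∀ g' g : Fin n, s'.iarr 6 (g' * n + g) = if (g', g) ∈ ws.take j then 1 else 0)
      ?_ ?_ ?_ ?_ ?_ ?_ ?_ ?_ ?_ ?_))) ?_ ?_
  · simp [IExp.val]
  · simp [IExp.val, h2]
  · omega
  · simpa [h2] using hwW
  · exact h1W
  · decide
  · decide
  · decide
  · simp [IExp.val, hz]
  · intro j s' hj hI hF hx
    simp only [Nat.zero_add] at hx
    have e0 : s'.ivar 0 = n := by rw [hF.ivar 0 (by decide)]; simpa using h0
    have e1 : s'.iarr 1 j = ws[j].1 := by rw [hF.iarr 1 (by decide)]; simpa using hsrc j hj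
    have e2 : s'.iarr 2 j = ws[j].2 := by rw [hF.iarr 2 (by decide)]; simpa using htgt j hj
    have hlt := mul_add_lt ws[j].1.2 ws[j].2.2
    have hl1 := ws[j].1.2
    have hl2 := ws[j].2.2
    refine Run.mono_time (Run.iput ?_ ?_ ?_) (by simp [IExp.cost])
    · simp only [IExp.Fits, IExp.val, hx, e0, e1, e2]
      omega
    · simp only [IExp.Fits]; omega
    · intro g' g
      simp only [IExp.val, hx, e0, e1, e2, Store.setI_iarr, Store.putI_iarr, if_true,
        List.take_add_one, List.getElem?_eq_getElem hj, Option.toList_some, List.mem_append,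
        List.mem_singleton]
      by_cases he : (g', g) = ws[j]
      · rw [← he]; simp
      · rw [Function.update_of_ne]
        · simpa [he] using hI g' g
        · intro h
          obtain ⟨a, b⟩ := mul_add_inj g.2 hl2 h
          exact he (Prod.ext (Fin.ext a) (Fin.ext b))
  · simp [IExp.cost]; omega
  · intro s' h _
    simpa using h

/-! ### The order of the nodes -/

/-- Count the children of all nodes. -/
def countProg : Prog :=
  .seq (.iset 6 (.lit 0)) (forLoop 6 3
    (.iput 7 (.get 3 (.var 6)) (.add (.get 7 (.get 3 (.var 6))) (.lit 1))))

/-- Put the leaves into the queue. -/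
def leavesProg : Prog :=
  .seq (.iset 6 (.lit 0)) (.seq (.iset 20 (.lit 0)) (forLoop 6 5
    (.ite (.eq (.get 7 (.var 6)) (.lit 0))
      (.seq (.iput 8 (.var 20) (.var 6)) (.iset 20 (.add (.var 20) (.lit 1)))) .skip)))

/-- Process the queue. -/
def queueProg : Prog :=
  .seq (.iset 6 (.lit 0)) (forLoop 6 3
    (.seq (.iset 8 (.get 3 (.get 8 (.var 6))))
      (.seq (.iput 7 (.var 8) (.sub (.get 7 (.var 8)) (.lit 1)))
        (.ite (.eq (.get 7 (.var 8)) (.lit 0))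
          (.seq (.iput 8 (.var 20) (.var 8)) (.iset 20 (.add (.var 20) (.lit 1)))) .skip))))

theorem run_countProg {W m : ℕ} {par : ℕ → ℕ} {s : Store} (h3 : s.ivar 3 = m)
    (hpar : ∀ b < m, s.iarr 3 b = par b) (hle : ∀ b < m, par b ≤ m) (hz : ∀ i, s.iarr 7 i = 0)
    (hmW : m + 1 < W) :
    Run W countProg s (m * 17 + 6) fun s' =>
      ∀ b, s'.iarr 7 b = ((Finset.range m).filter fun c => par c = b).card := by
  refine Run.mono_time (Run.seq_wp (Run.iset (by simp [IExp.Fits]; omega)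
    (Run.forLoop (lo := 0) (N := m) (tb := 9) (fun j s' =>
      ∀ b, s'.iarr 7 b = ((Finset.range j).filter fun c => par c = b).card)
      ?_ ?_ ?_ ?_ ?_ ?_ ?_ ?_ ?_ ?_))) ?_
  · simp [IExp.val]
  · simp [IExp.val, h3]
  · omega
  · simp [h3]; omega
  · omega
  · decide
  · decide
  · decide
  · simp [IExp.val, hz]
  · intro j s' hj hI hF hx
    simp only [Nat.zero_add] at hx
    have e1 : s'.iarr 3 j = par j := by rw [hF.iarr 3 (by decide)]; simpa using hpar j hj
    have hl := hle j hj
    have hc := Finset.card_filter_le (Finset.range j) fun c => par c = par j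
    rw [Finset.card_range] at hc
    refine Run.mono_time (Run.iput ?_ ?_ ?_) (by simp [IExp.cost])
    · simp only [IExp.Fits, IExp.val, hx, e1]
      omega
    · simp only [IExp.Fits, IExp.val, hx, e1, hI]
      omega
    · intro b
      simp only [IExp.val, hx, e1, Store.setI_iarr, Store.putI_iarr, if_true, Finset.range_add_one,
        Finset.filter_insert]
      by_cases hb : par j = b
      · subst hb
        rw [Function.update_self, hI, if_pos rfl, Finset.card_insert_of_notMem (by simp)]
      · rw [Function.update_of_ne (Ne.symm hb), hI, if_neg hb]
  · simp [IExp.cost]; omega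

/-- The loop runs over `m + 1` nodes because the invariant on zero counts includes the virtual node.
After `j` rounds the queue consists of the childless nodes below `j`. -/
theorem run_leavesProg {W m : ℕ} {par : ℕ → ℕ} {s : Store} (h5 : s.ivar 5 = m + 1)
    (hcnt : ∀ b, s.iarr 7 b = ((Finset.range m).filter fun c => par c = b).card)
    (hmW : m + 2 < W) :
    Run W leavesProg s ((m + 1) * 21 + 8) fun s' =>
      QueueInv m 0 (s'.ivar 20) par (s'.iarr 7) (s'.iarr 8) := by
  refine Run.mono (Run.seq_wp (Run.iset (by simp [IExp.Fits]; omega) (Run.seq_wp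
    (Run.iset (by simp [IExp.Fits]; omega)
    (Run.forLoop (lo := 0) (N := m + 1) (tb := 13) (fun j s' => s'.ivar 20 ≤ j ∧
      (∀ i < s'.ivar 20, s'.iarr 8 i < j ∧ s.iarr 7 (s'.iarr 8 i) = 0) ∧
      (∀ i < s'.ivar 20, ∀ i' < s'.ivar 20, s'.iarr 8 i = s'.iarr 8 i' → i = i') ∧
      (∀ b < j, s.iarr 7 b = 0 → ∃ i < s'.ivar 20, s'.iarr 8 i = b))
      ?_ ?_ ?_ ?_ ?_ ?_ ?_ ?_ ?_ ?_))))) ?_ ?_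
  · simp [IExp.val]
  · simp [IExp.val, h5]
  · omega
  · simp [h5]; omega
  · omega
  · decide
  · decide
  · decide
  · simp [IExp.val]
  · rintro j s' hj ⟨hI1, hI2, hI3, hI4⟩ hF hx
    simp only [Nat.zero_add] at hx
    have e7 : s'.iarr 7 = s.iarr 7 := by rw [hF.iarr 7 (by decide)]; simp
    have hc : s.iarr 7 j ≤ m := by
      rw [hcnt]
      exact (Finset.card_filter_le _ _).trans (by simp)
    refine Run.mono_time (Run.ite ?_ (fun hb => Run.seq_wp (Run.iput ?_ ?_ (Run.iset ?_ ?_)))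
      (fun hb => Run.skip ?_)) (by simp [IExp.cost, BExp.cost])
    · simp only [BExp.Fits, IExp.Fits, IExp.val, hx, e7]; omega
    · simp only [IExp.Fits]; omega
    · simp only [IExp.Fits, hx]; omega
    · simp [IExp.Fits, IExp.val]; omega
    · simp only [BExp.Holds, IExp.val, hx, e7] at hb
      simp only [IExp.val, hx, Store.setI_ivar, Store.putI_ivar, Store.setI_iarr,
        Store.putI_iarr, if_true, if_neg (show ¬ (20 : ℕ) = 6 by decide)]
      refine ⟨by omega, fun i hi => ?_, fun i hi i' hi' => ?_, fun b hb' hb0 => ?_⟩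
      · by_cases h : i = s'.ivar 20
        · rw [h, Function.update_self]; exact ⟨by omega, hb⟩
        · rw [Function.update_of_ne h]
          have := hI2 i (by omega)
          exact ⟨by omega, this.2⟩
      · have key : ∀ i < s'.ivar 20, s'.iarr 8 i ≠ j := fun i hi => (hI2 i hi).1.ne
        by_cases h : i = s'.ivar 20 <;> by_cases h' : i' = s'.ivar 20
        · omega
        · rw [h, Function.update_self, Function.update_of_ne h']
          intro e; exact absurd e.symm (key i' (by omega))
        · rw [h', Function.update_self, Function.update_of_ne h]
          intro e; exact absurd e (key i (by omega))
        · rw [Function.update_of_ne h, Function.update_of_ne h']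
          exact hI3 i (by omega) i' (by omega)
      · by_cases h : b = j
        · exact ⟨s'.ivar 20, by omega, by rw [Function.update_self, h]⟩
        · obtain ⟨i, hi, e⟩ := hI4 b (by omega) hb0
          exact ⟨i, by omega, by rw [Function.update_of_ne hi.ne, e]⟩
    · simp only [BExp.Holds, IExp.val, hx, e7] at hb
      simp only [Store.setI_ivar, Store.setI_iarr, if_neg (show ¬ (20 : ℕ) = 6 by decide)]
      refine ⟨by omega, fun i hi => ⟨?_, (hI2 i hi).2⟩, hI3, fun b hb' hb0 => ?_⟩
      · have := (hI2 i hi).1; omega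
      · have : b ≠ j := by rintro rfl; exact hb hb0
        exact hI4 b (by omega) hb0
  · simp [IExp.cost]; omega
  · rintro s' ⟨hI1, hI2, hI3, hI4⟩ hF
    have e7 : s'.iarr 7 = s.iarr 7 := hF.iarr 7 (by decide)
    rw [e7]
    refine ⟨by omega, fun b _ => ?_, fun j hj => ?_, by simp, hI3, fun b hb => ⟨fun h => ?_, ?_⟩,
      fun j hj c hc hcj => ?_⟩
    · simp [hcnt]
    · have := (hI2 j hj).1; omega
    · exact hI4 b (by omega) h
    · rintro ⟨j, hj, rfl⟩; exact (hI2 j hj).2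
    · have h0 := (hI2 j hj).2
      rw [hcnt, Finset.card_eq_zero, Finset.filter_eq_empty_iff] at h0
      exact absurd hcj (h0 (Finset.mem_range.2 hc))

theorem run_queueProg {W m : ℕ} {par dep : ℕ → ℕ} {s : Store} (h3 : s.ivar 3 = m)
    (hpar : ∀ b < m, s.iarr 3 b = par b) (hle : ∀ b < m, par b ≤ m)
    (hdep : ∀ b < m, dep b = dep (par b) + 1)
    (hI : QueueInv m 0 (s.ivar 20) par (s.iarr 7) (s.iarr 8)) (hmW : m + 2 < W) :
    Run W queueProg s (m * 33 + 6) fun s' => IsOrder m par (s'.iarr 8) := by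
  refine Run.mono (Run.seq_wp (Run.iset (by simp [IExp.Fits]; omega)
    (Run.forLoop (lo := 0) (N := m) (tb := 25) (fun j s' =>
      QueueInv m j (s'.ivar 20) par (s'.iarr 7) (s'.iarr 8))
      ?_ ?_ ?_ ?_ ?_ ?_ ?_ ?_ ?_ ?_))) ?_ ?_
  · simp [IExp.val]
  · simp [IExp.val, h3]
  · omega
  · simp [h3]; omega
  · omega
  · decide
  · decide
  · decide
  · simpa [IExp.val] using hI
  · intro j s' hj hI hF hx
    simp only [Nat.zero_add] at hx
    obtain ⟨h1, h2⟩ := hI.next hj hdep hle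
    have e3 : s'.iarr 3 (s'.iarr 8 j) = par (s'.iarr 8 j) := by
      rw [hF.iarr 3 (by decide)]; simpa using hpar _ h2
    have hp := hle _ h2
    have hc : s'.iarr 7 (par (s'.iarr 8 j)) ≤ m := by
      rw [hI.cnt_eq _ hp]
      exact (Finset.card_filter_le _ _).trans (by simp)
    have htl := hI.tail_le
    -- The word bound for the incremented tail comes from pigeonhole, applied to the queue as it
    -- will be after the push.
    have htl' : s'.iarr 7 (par (s'.iarr 8 j)) - 1 = 0 → s'.ivar 20 + 1 ≤ m + 1 := by
      intro h0
      refine QueueInv.tail_le (hI.step h1 h2 hp rfl (tail' := s'.ivar 20 + 1)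
        (Q' := Function.update (s'.iarr 8) (s'.ivar 20) (par (s'.iarr 8 j)))
        (fun _ => ⟨rfl, rfl⟩) (fun h => absurd h0 h))
    refine Run.mono_time (Run.seq_wp (Run.iset ?_ (Run.seq_wp (Run.iput ?_ ?_
      (Run.ite ?_ (fun hb => Run.seq_wp (Run.iput ?_ ?_ (Run.iset ?_ ?_)))
      (fun hb => Run.skip ?_)))))) (by simp [IExp.cost, BExp.cost])
    · simp only [IExp.Fits, IExp.val, hx, e3]; omega
    · simp [IExp.Fits, IExp.val, hx, e3]; omega
    · simp [IExp.Fits, IExp.val, hx, e3]; omega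
    · simp [BExp.Fits, IExp.Fits, IExp.val, hx, e3]; omega
    · simp [IExp.Fits, IExp.val]; omega
    · simp [IExp.Fits, IExp.val, hx, e3]; omega
    · simp [IExp.Fits, IExp.val]; omega
    · simp [BExp.Holds, IExp.val, hx, e3] at hb
      refine hI.step h1 h2 hp ?_ (fun h0 => ?_) (fun h0 => ?_)
      · simp [IExp.val, hx, e3]
      · simp [IExp.val, hx, e3]
      · omega
    · simp [BExp.Holds, IExp.val, hx, e3] at hb
      refine hI.step h1 h2 hp ?_ (fun h0 => ?_) (fun h0 => ?_)
      · simp [IExp.val, hx, e3]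
      · omega
      · simp
  · simp [IExp.cost]; omega
  · intro s' h _
    exact h.isOrder hle

/-! ### The sizes of the tables -/

/-- Write the sizes of the tables into the array 9 and ones into the tables. -/
def sizeProg : Prog :=
  .seq (.iset 6 (.lit 0)) (forLoop 6 5
    (.seq (.iset 12 (.lit 1)) (.seq (bagLoop 6 13 14 15 (.iset 12 (.mul (.var 12) (.lit 3))))
      (.seq (.iput 9 (.var 6) (.var 12)) (.seq (.iset 11 (.lit 0))
        (forLoop 11 12 (.rput 1 (.add (.mul (.var 11) (.var 5)) (.var 6)) (.lit 1))))))))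

/-- Tables are interleaved: entry `i` of node `b` lies in cell `i * (m + 1) + b`, so that no table
offsets are needed. The ones are the empty products from which the tables start. -/
theorem run_sizeProg {W n m K : ℕ} {L : ℕ → List (Fin n)} {s : Store} (hS : HoldsBags W n m L s)
    (hK : ∀ b, (L b).length ≤ K) (hnW : n < W) (hmW : m + 1 < W) (h3W : 3 < W)
    (hKW : 3 ^ K < W)
    (hKmW : 3 ^ K * (m + 1) < W) :
    Run W sizeProg s ((m + 1) * (K * 15 + 3 ^ K * 16 + 36) + 6) fun s' =>
      ∀ b ≤ m, s'.iarr 9 b = 3 ^ (L b).length ∧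
        ∀ i < 3 ^ (L b).length, s'.rarr 1 (i * (m + 1) + b) = 1 := by
  refine Run.mono (Run.seq_wp (Run.iset (by simp [IExp.Fits]; omega)
    (Run.forLoop (lo := 0) (N := m + 1) (tb := K * 15 + 3 ^ K * 16 + 28) (fun j s' =>
      ∀ b < j, s'.iarr 9 b = 3 ^ (L b).length ∧
        ∀ i < 3 ^ (L b).length, s'.rarr 1 (i * (m + 1) + b) = 1)
      ?_ ?_ ?_ ?_ ?_ ?_ ?_ ?_ ?_ ?_))) ?_ ?_
  · simp [IExp.val]
  · simp [IExp.val, hS.m1_eq]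
  · omega
  · simp [hS.m1_eq]; omega
  · omega
  · decide
  · decide
  · decide
  · simp
  · intro j s' hj hI hF hx
    simp only [Nat.zero_add] at hx
    have hS' : HoldsBags W n m L s' := (hS.congr le_rfl (Agree.setI 5 s (by decide))).congr le_rfl
      (Agree.of_frame hF (by decide) (by decide) (by decide))
    have hlen := hK j
    have hpow : 3 ^ (L j).length ≤ 3 ^ K := Nat.pow_le_pow_right (by norm_num) hlen
    refine Run.mono_time (Run.seq_wp (Run.iset (by simp [IExp.Fits]; omega)
      (Run.seq (Run.bagLoop (L := L) (b := j) (tb := 4)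
        (fun q s'' => s''.ivar 12 = 3 ^ q)
        (hS'.congr le_rfl (Agree.setI 5 s' (by decide))) hnW.le hmW ?_ (by omega) (by decide)
        (by decide) (by decide) (by decide) (by decide) (by decide) (by decide) (by decide)
        (by decide) ?_ ?_) ?_))) ?_ (T := 2 + ((L j).length * (4 + 11) + 13 +
          (3 + (2 + (3 ^ (L j).length * (8 + 8) + 4)))))
    · simp [hx]
    · simp [IExp.val]
    · intro q s2 hq hq2 hF2
      refine Run.iset ?_ ?_
      · have : 3 ^ (q + 1) ≤ 3 ^ K := Nat.pow_le_pow_right (by norm_num) (by omega)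
        have h' : 3 ^ (q + 1) = 3 ^ q * 3 := pow_succ 3 q
        simp [IExp.Fits, IExp.val, hq2]; omega
      · intro v
        simp [IExp.val, hq2, pow_succ]
    · intro s2 h12 hF2
      have e6 : s2.ivar 6 = j := by rw [hF2.ivar 6 (by decide)]; simpa using hx
      have e5 : s2.ivar 5 = m + 1 := by rw [hF2.ivar 5 (by decide)]; simpa using hS'.m1_eq
      have e9 : s2.iarr 9 = s'.iarr 9 := by rw [hF2.iarr 9 (by decide)]; simp
      have er : s2.rarr 1 = s'.rarr 1 := by rw [hF2.rarr 1 (by decide)]; simp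
      -- The inner invariant states that the tables of earlier nodes survive and that the current
      -- table is filled below `i`. Cells of different nodes are distinct since their indices differ
      -- modulo `m + 1`.
      refine Run.seq_wp (Run.iput ?_ ?_ (Run.seq_wp (Run.iset ?_
        (Run.mono (Run.forLoop (lo := 0) (N := 3 ^ (L j).length) (tb := 8) (fun i s3 =>
          (∀ b < j, ∀ i < 3 ^ (L b).length, s3.rarr 1 (i * (m + 1) + b) = 1) ∧
          (∀ i' < i, s3.rarr 1 (i' * (m + 1) + j) = 1))
          ?_ ?_ ?_ ?_ ?_ ?_ ?_ ?_ ?_ ?_) le_rfl ?_))))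
      · simp [IExp.Fits, e6]; omega
      · simp [IExp.Fits, h12]; omega
      · simp [IExp.Fits]; omega
      · simp [IExp.val]
      · simp [h12]
      · omega
      · simp [h12]; omega
      · omega
      · decide
      · decide
      · decide
      · simp only [Store.setI_rarr, Store.putI_rarr, er]
        exact ⟨fun b hb => (hI b hb).2, by simp⟩
      · rintro i s3 hi ⟨hi1, hi2⟩ hF3 hx3
        simp only [Nat.zero_add] at hx3
        have e6' : s3.ivar 6 = j := by rw [hF3.ivar 6 (by decide)]; simpa using e6
        have e5' : s3.ivar 5 = m + 1 := by rw [hF3.ivar 5 (by decide)]; simpa using e5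
        have hlt : i * (m + 1) + j < 3 ^ K * (m + 1) := mul_add_lt (by omega) hj
        refine Run.mono_time (Run.rput ?_ ?_ ?_) (by simp [IExp.cost, RExp.cost])
        · simp only [IExp.Fits, IExp.val, hx3, e5', e6']; omega
        · simp [RExp.Fits]
        · simp only [IExp.val, RExp.val, hx3, e5', e6', Store.setI_rarr, Store.putR_rarr, if_true]
          constructor
          · intro b hb i' hi'
            rw [Function.update_of_ne, hi1 b hb i' hi']
            intro h
            have := (mul_add_inj (by omega) hj h).2
            omega
          · intro i' hi'
            by_cases h : i' = i
            · rw [h, Function.update_self]; simp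
            · rw [Function.update_of_ne, hi2 i' (by omega)]
              intro h'
              exact h (mul_add_inj hj hj h').1
      · rintro s3 ⟨hs1, hs2⟩ hF3 b hb
        have e9' : s3.iarr 9 = Function.update (s'.iarr 9) j (3 ^ (L j).length) := by
          rw [hF3.iarr 9 (by decide)]; simp [IExp.val, e6, h12, e9]
        simp only [Store.setI_iarr, Store.setI_rarr, e9']
        by_cases h : b = j
        · rw [h, Function.update_self]; exact ⟨rfl, hs2⟩
        · rw [Function.update_of_ne h]
          exact ⟨(hI b (by omega)).1, hs1 b (by omega)⟩
    · omega
  · have : K * 15 + 3 ^ K * 16 + 28 + 8 = K * 15 + 3 ^ K * 16 + 36 := rfl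
    rw [this]
    simp only [IExp.cost]; omega
  · intro s' h _ b hb
    exact h b (by omega)

/-! ### The tables -/

theorem prod_map_take_succ {α : Type} (l : List α) (f : α → ℝ) {q : ℕ} (hq : q < l.length) :
    ((l.take (q + 1)).map f).prod = ((l.take q).map f).prod * f l[q] := by
  simp only [List.map_take]
  rw [List.prod_take_succ _ _ (by simpa using hq), List.getElem_map]

/-- Equivalence of tests. -/
def BExp.iff (p q : BExp) : BExp := .conj (.neg (.conj p (.neg q))) (.neg (.conj q (.neg p)))

@[simp] theorem BExp.holds_iff {s : Store} {p q : BExp} :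
    (p.iff q).Holds s ↔ (p.Holds s ↔ q.Holds s) := by
  simp only [BExp.iff, BExp.Holds]; tauto

@[simp] theorem BExp.fits_iff {W : ℕ} {s : Store} {p q : BExp} :
    (p.iff q).Fits W s ↔ p.Fits W s ∧ q.Fits W s := by
  simp only [BExp.iff, BExp.Fits]; tauto

@[simp] theorem BExp.cost_iff {p q : BExp} :
    (p.iff q).cost = 2 * p.cost + 2 * q.cost + 7 := by
  simp only [BExp.iff, BExp.cost]; omega

/-- The index of the cell that holds the state of the gate `g` in the node `b`. -/
def cell (b g : ℕ) : IExp := .add (.mul (.var b) (.var 0)) (.var g)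

/-- The state plus one (zero if there is none) of the gate in register `g` in the node in
register `b`. -/
def stateOf (b g : ℕ) : IExp := .get 10 (cell b g)

/-- The test whether the gate in register `g` has the value `true` in the node in register 7. -/
def valTest (g : ℕ) : BExp := .iff (.eq (stateOf 7 g) (.lit 1)) (.eq (.get 0 (.var g)) (.lit 3))

/-- Decode the register 19 into states of the gates in the bag of the node in register `b`. -/
def decodeProg (b : ℕ) : Prog :=
  bagLoop b 13 14 15 (.seq
    (.iput 10 (cell b 15)
      (.add (.sub (.var 19) (.mul (.lit 3) (.div (.var 19) (.lit 3)))) (.lit 1)))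
    (.iset 19 (.div (.var 19) (.lit 3))))

/-- Multiply the real register 1 by the weight of the gate in register 15. -/
def weightProg : Prog :=
  .ite (.conj (.eq (.var 15) (.var 1)) (.neg (valTest 15))) (.rset 1 (.lit 0))
    (.ite (.eq (.get 0 (.var 15)) (.lit 0))
      (.ite (.eq (stateOf 7 15) (.lit 1))
        (.rset 1 (.mul (.var 1) (.add (.lit 1) (.mul (.lit (-1)) (.get 0 (.var 15))))))
        (.ite (.eq (stateOf 7 15) (.lit 2)) (.rset 1 (.mul (.var 1) (.get 0 (.var 15))))
          (.rset 1 (.lit 0))))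
      (.ite (.eq (stateOf 7 15) (.lit 3)) (.rset 1 (.mul (.var 1) (.lit (-1)))) .skip))

/-- Set the real register 1 to zero if a wire from the gate in register 18 to the gate in
register 15 is not respected. -/
def wireProg : Prog :=
  .ite (.conj (.eq (.get 6 (cell 18 15)) (.lit 1)) (.conj (.neg (.eq (stateOf 7 15) (.lit 2)))
      (.neg (.iff (valTest 18) (.neg (.eq (.get 0 (.var 15)) (.lit 2)))))))
    (.rset 1 (.lit 0)) .skip

/-- Multiply the real register 1 by the weight of the gate in register 15, if it is not in the
bag of the parent, and check its states and its wires. -/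
def gateProg : Prog :=
  .seq (.ite (.eq (stateOf 8 15) (.lit 0)) weightProg
      (.ite (.eq (stateOf 8 15) (stateOf 7 15)) .skip (.rset 1 (.lit 0))))
    (bagLoop 7 16 17 18 wireProg)

/-- Add one summand of the message to the real register 2. -/
def summandProg : Prog :=
  .seq (.iset 19 (.var 11)) (.seq (decodeProg 7)
    (.seq (.rset 1 (.get 1 (.add (.mul (.var 11) (.var 5)) (.var 7))))
      (.seq (bagLoop 7 13 14 15 gateProg) (.rset 2 (.add (.var 2) (.var 1))))))

/-- Multiply one entry of the table of the parent by the message. -/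
def entryProg : Prog :=
  .seq (.iset 19 (.var 9)) (.seq (decodeProg 8) (.seq (.rset 2 (.lit 0)) (.seq (.iset 11 (.lit 0))
    (.seq (forLoop 11 12 summandProg)
      (.rput 1 (.add (.mul (.var 9) (.var 5)) (.var 8))
        (.mul (.get 1 (.add (.mul (.var 9) (.var 5)) (.var 8))) (.var 2)))))))

/-- Pass the message of a node to its parent. -/
def nodeProg : Prog :=
  .seq (.iset 7 (.get 8 (.var 6))) (.seq (.iset 8 (.get 3 (.var 7)))
    (.seq (.iset 10 (.get 9 (.var 8))) (.seq (.iset 12 (.get 9 (.var 7)))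
      (.seq (.iset 9 (.lit 0)) (forLoop 9 10 entryProg)))))

/-- Pass all messages and read off the result. -/
def tableProg : Prog :=
  .seq (.iset 6 (.lit 0)) (.seq (forLoop 6 3 nodeProg) (.rset 0 (.get 1 (.var 3))))

/-- The words are large enough for all indices. -/
structure WordBounds (W n m K : ℕ) : Prop where
  n_lt : n < W
  m_lt : m + 1 < W
  const_lt : 4 < W
  nn_lt : n * n < W
  mn_lt : (m + 1) * n < W
  pow_lt : 3 ^ K < W
  table_lt : 3 ^ K * (m + 1) < W

section

variable {n m : ℕ} {C : Circuit (Fin n)} (T : TreeDecomposition C (Fin m))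
  (π : C.Var → unitInterval) (bl : Fin m → List (Fin n)) (Q : ℕ → ℕ)

open Classical in
/-- The data that are not changed while the messages are passed. -/
structure Env (W : ℕ) (s : Store) : Prop where
  bags : HoldsBags W n m (nodeBag bl) s
  out : s.ivar 1 = C.output
  type : ∀ g : Fin n, s.iarr 0 g = (C.type g).code
  prob : ∀ g : Fin n, C.type g = GateType.var → s.rarr 0 g = C.gateProb π g
  par : ∀ b < m, s.iarr 3 b = nodeParent T b
  adj : ∀ g' g : Fin n, s.iarr 6 (g' * n + g) = if C.Wire g' g then 1 else 0
  queue : s.iarr 8 = Q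
  size : ∀ b ≤ m, s.iarr 9 b = 3 ^ (nodeBag bl b).length

variable {T π bl Q} {W K : ℕ}

/-- Message passing writes only to registers above 5, integer array 10, real registers and real
array 1, so the environment persists throughout. -/
theorem Env.congr {s s' : Store} (h : Env T π bl Q W s) (h' : Agree 9 s s') :
    Env T π bl Q W s' := by
  refine ⟨h.bags.congr (by norm_num) h', ?_, ?_, ?_, ?_, ?_, ?_, ?_⟩
  · rw [h'.ivar 1 (by norm_num), h.out]
  · rw [h'.iarr 0 (by norm_num)]; exact h.type
  · rw [h'.rarr]; exact h.prob
  · rw [h'.iarr 3 (by norm_num)]; exact h.par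
  · rw [h'.iarr 6 (by norm_num)]; exact h.adj
  · rw [h'.iarr 8 (by norm_num), h.queue]
  · rw [h'.iarr 9 (by norm_num)]; exact h.size

variable (bl)

/-- The cells of the gates that are not in the bag are zero. -/
def Clean (s : Store) : Prop :=
  ∀ b ≤ m, ∀ g : Fin n, g ∉ nodeBag bl b → s.iarr 10 (b * n + g) = 0

/-- The cell of the gate `g` if the bag `b` has the states that `i` encodes. -/
def cellValue (b i : ℕ) (g : Fin n) : ℕ :=
  if g ∈ nodeBag bl b then (decode (nodeBag bl b) i g : ℕ) + 1 else 0

variable {bl}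

/-- States are stored with 1 added, so a zero cell means "not in the bag" and membership is a single
look-up. Each decoding overwrites all cells of the bag and no others, so nothing has to be cleared
between decodings. -/
theorem run_decodeProg {s : Store} {bx b i : ℕ} (hW : WordBounds W n m K)
    (hS : HoldsBags W n m (nodeBag bl) s) (hbl : T.ListsBags bl)
    (hK : (nodeBag bl b).length ≤ K) (hC : Clean bl s)
    (hbx : bx = 7 ∨ bx = 8) (hb : s.ivar bx = b) (hbm : b ≤ m) (hi : s.ivar 19 = i)
    (hiW : i < W) :
    Run W (decodeProg bx) s (K * 30 + 13) fun s' =>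
      Clean bl s' ∧ (∀ g : Fin n, s'.iarr 10 (b * n + g) = cellValue bl b i g) ∧
        ∀ b' ≠ b, ∀ g : Fin n, s'.iarr 10 (b' * n + g) = s.iarr 10 (b' * n + g) := by
  have hnd := nodeBag_nodup hbl b
  have hm := hW.m_lt
  have h4 := hW.const_lt
  refine Run.mono (Run.bagLoop (L := nodeBag bl) (b := b) (tb := 19) (fun q s' =>
    s'.ivar 19 = i / 3 ^ q ∧
    (∀ b' (g : Fin n), b' ≠ b ∨ g ∉ nodeBag bl b →
      s'.iarr 10 (b' * n + g) = s.iarr 10 (b' * n + g)) ∧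
    ∀ r (hr : r < (nodeBag bl b).length), r < q →
      s'.iarr 10 (b * n + (nodeBag bl b)[r]) = i / 3 ^ r % 3 + 1)
    hS hW.n_lt.le hW.m_lt hb hbm ?_ (by decide) (by decide) (by decide) ?_ ?_ ?_ ?_ ?_ ?_ ?_)
    (by gcongr) ?_
  · rcases hbx with rfl | rfl <;> decide
  · rcases hbx with rfl | rfl <;> decide
  · rcases hbx with rfl | rfl <;> decide
  · rcases hbx with rfl | rfl <;> decide
  · rcases hbx with rfl | rfl <;> decide
  · rcases hbx with rfl | rfl <;> decide
  · intro v v'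
    simp [hi]
  · rintro q s' hq ⟨h1, h2, h3⟩ hF
    have e0 : s'.ivar 0 = n := by
      rw [hF.ivar 0 (by rcases hbx with rfl | rfl <;> decide), hS.n_eq]
    have eb : s'.ivar bx = b := by
      rw [hF.ivar bx (by rcases hbx with rfl | rfl <;> decide), hb]
    have hbx15 : bx ≠ 15 := by omega
    have hg := (nodeBag bl b)[q].2
    have hlt := mul_add_lt (show b < m + 1 by omega) hg
    have hmn := hW.mn_lt
    have hnW := hW.n_lt
    have hdiv : i / 3 ^ q ≤ i := Nat.div_le_self _ _
    -- The machine has no remainder operation; it is recovered from truncated division.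
    have hmod : i / 3 ^ q - 3 * (i / 3 ^ q / 3) = i / 3 ^ q % 3 := by omega
    refine Run.mono_time (Run.seq_wp (Run.iput ?_ ?_ (Run.iset ?_ ?_)))
      (by simp [IExp.cost, cell])
    · simp [cell, IExp.Fits, IExp.val, e0, eb, hbx15]; omega
    · simp [IExp.Fits, IExp.val, h1]; omega
    · simp [IExp.Fits, h1]; omega
    · intro v
      simp only [cell, IExp.val, Store.setI_ivar, Store.setI_iarr, Store.putI_ivar,
        Store.putI_iarr, if_true, e0, eb, hbx15, h1, if_false, hmod,
        if_neg (show ¬ (19 : ℕ) = 15 by decide), if_neg (show ¬ (19 : ℕ) = 13 by decide),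
        if_neg (show ¬ (0 : ℕ) = 15 by decide)]
      refine ⟨?_, fun b' g hbg => ?_, fun r hr hrq => ?_⟩
      · rw [Nat.div_div_eq_div_mul, pow_succ]
      · rw [Function.update_of_ne, h2 b' g hbg]
        intro h
        obtain ⟨a1, a2⟩ := mul_add_inj g.2 hg h
        rcases hbg with h' | h'
        · exact h' a1
        · exact h' (by rw [Fin.ext a2]; exact List.getElem_mem hq)
      · by_cases h : r = q
        · subst h; rw [Function.update_self]
        · rw [Function.update_of_ne, h3 r hr (by omega)]
          intro h'
          have := (mul_add_inj (nodeBag bl b)[r].2 hg h').2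
          exact h ((hnd.getElem_inj_iff).1 (Fin.ext this))
  · rintro s' ⟨_, h2, h3⟩ _
    refine ⟨fun b' hb' g hg => ?_, fun g => ?_, fun b' hb' g => h2 b' g (Or.inl hb')⟩
    · rw [h2, hC b' hb' g hg]
      by_cases h : b' = b
      · subst h; exact Or.inr hg
      · exact Or.inl h
    · unfold cellValue
      split_ifs with hg
      · obtain ⟨q, hq, rfl⟩ := List.getElem_of_mem hg
        rw [h3 q hq hq, decode_getElem hnd]
      · rw [h2 b g (Or.inr hg), hC b hbm g hg]

theorem GateType.code_lt (t : GateType) : t.code < 4 := by cases t <;> decide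
theorem GateType.code_eq_zero {t : GateType} : t.code = 0 ↔ t = GateType.var := by
  cases t <;> decide
theorem GateType.code_eq_two {t : GateType} : t.code = 2 ↔ t = GateType.or := by
  cases t <;> decide
theorem GateType.code_eq_three {t : GateType} : t.code = 3 ↔ t = GateType.and := by
  cases t <;> decide

/-! ### The weight and the wires of a single gate -/

section Gate

variable {s : Store} {c : ℕ} {g : Fin n} {d : Fin 3} (hW : WordBounds W n m K)
  (hE : Env T π bl Q W s) (hc : s.ivar 7 = c) (hcm : c ≤ m)

include hW hE

theorem fits_stateOf {x y b : ℕ} (hx : s.ivar x = b) (hb : b ≤ m) (hy : s.ivar y = g) {v : ℕ}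
    (hv : s.iarr 10 (b * n + g) = v) (hv4 : v < 4) :
    (stateOf x y).Fits W s ∧ (stateOf x y).val s = v := by
  have := mul_add_lt (show b < m + 1 by omega) g.2
  have h1 := hW.mn_lt
  have h2 := hW.n_lt
  have h3 := hW.m_lt
  have h4 := hW.const_lt
  have h0 := hE.bags.n_eq
  have hg := g.2
  simp only [stateOf, cell, IExp.Fits, IExp.val, hx, hy, h0, hv, and_true]
  omega

include hc hcm

theorem valTest_spec {y : ℕ} (hy : s.ivar y = g) (hd : s.iarr 10 (c * n + g) = d + 1) :
    (valTest y).Fits W s ∧ ((valTest y).Holds s ↔ (C.type g).Val d) := by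
  obtain ⟨h1, h2⟩ := fits_stateOf hW hE hc hcm hy hd (by omega)
  have h4 := hW.const_lt
  have hn := hW.n_lt
  have hg := g.2
  have ht := hE.type g
  have hlt := (C.type g).code_lt
  constructor
  · simp only [valTest, BExp.fits_iff, BExp.Fits, IExp.Fits, IExp.val, h1, hy, ht, true_and]
    omega
  · simp only [valTest, BExp.holds_iff, BExp.Holds, h2, IExp.val, hy, ht,
      GateType.code_eq_three, GateType.Val]
    refine iff_congr ?_ Iff.rfl
    rw [Fin.ext_iff]; simp

theorem run_weightProg (hy : s.ivar 15 = g) (hd : s.iarr 10 (c * n + g) = d + 1) :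
    Run W weightProg s 150 fun s' => s'.rvar 1 = s.rvar 1 * C.weight π g d := by
  obtain ⟨h1, h2⟩ := fits_stateOf hW hE hc hcm hy hd (by omega)
  obtain ⟨h3, h4⟩ := valTest_spec hW hE hc hcm hy hd
  have hcW := hW.const_lt
  have hn := hW.n_lt
  have hg := g.2
  have ho := C.output.2
  have ht := hE.type g
  have hlt := (C.type g).code_lt
  have hout : s.ivar 1 = C.output := hE.out
  have hd0 : (d : ℕ) + 1 = 1 ↔ d = 0 := by rw [Fin.ext_iff]; simp
  have hd1 : (d : ℕ) + 1 = 2 ↔ d = 1 := by rw [Fin.ext_iff]; simp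
  have hd2 : (d : ℕ) + 1 = 3 ↔ d = 2 := by rw [Fin.ext_iff]; simp
  have hog : (g : ℕ) = C.output ↔ g = C.output := Fin.ext_iff.symm
  refine Run.mono_time (Run.ite ?_ (fun hb => Run.rset ?_ ?_) (fun hb => Run.ite ?_
    (fun hb' => Run.ite ?_ (fun hb2 => Run.rset ?_ ?_) (fun hb2 => Run.ite ?_
      (fun hb3 => Run.rset ?_ ?_) (fun hb3 => Run.rset ?_ ?_)))
    (fun hb' => Run.ite ?_ (fun hb2 => Run.rset ?_ ?_) (fun hb2 => Run.skip ?_))))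
    (by simp [BExp.cost, IExp.cost, RExp.cost, valTest, stateOf, cell])
  · simp only [BExp.Fits, IExp.Fits, hy, hout, h3, and_true]; omega
  · simp only [RExp.Fits]
  · simp only [BExp.Holds, IExp.val, hy, hout, h4, hog] at hb
    rw [Circuit.weight, if_pos hb]
    simp [RExp.val]
  · simp only [BExp.Fits, IExp.Fits, IExp.val, hy, ht]; omega
  · simp only [BExp.Fits, IExp.Fits, h1, true_and]; omega
  · simp only [RExp.Fits, IExp.Fits, hy, true_and]; omega
  · simp only [BExp.Holds, IExp.val, hy, hout, h4, hog, ht, h2, hd0,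
      GateType.code_eq_zero] at hb hb' hb2
    rw [Circuit.weight, if_neg hb]
    simp [hb', hb2, RExp.val, IExp.val, hy, hE.prob g hb']
    -- Reals cannot be subtracted, so the program forms `1 - p` as `1 + (-1) * p`.
    exact Or.inl (by ring)
  · simp only [BExp.Fits, IExp.Fits, h1, true_and]; omega
  · simp only [RExp.Fits, IExp.Fits, hy, true_and]; omega
  · simp only [BExp.Holds, IExp.val, hy, hout, h4, hog, ht, h2, hd0, hd1,
      GateType.code_eq_zero] at hb hb' hb2 hb3
    rw [Circuit.weight, if_neg hb]
    simp [hb', hb3, RExp.val, IExp.val, hy, hE.prob g hb']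
  · simp only [RExp.Fits]
  · simp only [BExp.Holds, IExp.val, hy, hout, h4, hog, ht, h2, hd0, hd1,
      GateType.code_eq_zero] at hb hb' hb2 hb3
    rw [Circuit.weight, if_neg hb]
    simp [hb', hb2, hb3, RExp.val]
  · simp only [BExp.Fits, IExp.Fits, h1, true_and]; omega
  · simp only [RExp.Fits, and_true]
  · simp only [BExp.Holds, IExp.val, hy, hout, h4, hog, ht, h2, hd2,
      GateType.code_eq_zero] at hb hb' hb2
    rw [Circuit.weight, if_neg hb]
    simp [hb', hb2, RExp.val]
  · simp only [BExp.Holds, IExp.val, hy, hout, h4, hog, ht, h2, hd2,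
      GateType.code_eq_zero] at hb hb' hb2
    rw [Circuit.weight, if_neg hb]
    simp [hb', hb2]

-- Thanks to the adjacency matrix a pair of gates is checked in constant time, whatever the fan-in.
-- A bag of size K thus costs O(K²) per summand.
open Classical in
theorem run_wireProg (hy : s.ivar 15 = g) {g' : Fin n} (hy' : s.ivar 18 = g') {d' : Fin 3}
    (hd : s.iarr 10 (c * n + g) = d + 1) (hd' : s.iarr 10 (c * n + g') = d' + 1) :
    Run W wireProg s 150 fun s' => s'.rvar 1 = s.rvar 1 *
      if C.Wire g' g ∧ ¬ WireOK (C.type g') (C.type g) d' d then 0 else 1 := by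
  obtain ⟨h1, h2⟩ := fits_stateOf hW hE hc hcm hy hd (by omega)
  obtain ⟨h3, h4⟩ := valTest_spec hW hE hc hcm hy' hd'
  have hcW := hW.const_lt
  have hn := hW.n_lt
  have hg := g.2
  have hg' := g'.2
  have hlt' := mul_add_lt hg' hg
  have hnn := hW.nn_lt
  have ht := hE.type g
  have h0 := hE.bags.n_eq
  have hlt := (C.type g).code_lt
  have hadj := hE.adj g' g
  have hadjW : s.iarr 6 (g' * n + g) < W := by rw [hadj]; split_ifs <;> omega
  have hd1 : (d : ℕ) + 1 = 2 ↔ d = 1 := by rw [Fin.ext_iff]; simp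
  have hiff : (BExp.conj (.eq (.get 6 (cell 18 15)) (.lit 1)) (.conj (.neg (.eq (stateOf 7 15)
      (.lit 2))) (.neg (.iff (valTest 18) (.neg (.eq (.get 0 (.var 15)) (.lit 2))))))).Holds s ↔
      C.Wire g' g ∧ ¬ WireOK (C.type g') (C.type g) d' d := by
    simp only [BExp.Holds, BExp.holds_iff, IExp.val, cell, h4, h2, hy, hy', h0, hadj, ht, hd1,
      GateType.code_eq_two, WireOK]
    simp
  refine Run.mono_time (Run.ite ?_ (fun hb => Run.rset ?_ ?_) (fun hb => Run.skip ?_))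
    (by simp [BExp.cost, IExp.cost, RExp.cost, valTest, stateOf, cell])
  · simp only [BExp.Fits, BExp.fits_iff, IExp.Fits, IExp.val, cell, h1, h3, hy, hy', h0, ht,
      true_and]
    omega
  · simp only [RExp.Fits]
  · rw [if_pos (hiff.1 hb)]
    simp [RExp.val]
  · rw [if_neg (fun h => hb (hiff.2 h)), mul_one]

end Gate

open Classical in
variable (C π bl) in
/-- The contribution of the gate `g` in the bag of `c` to a summand of the message from `c` to
`p`. -/
noncomputable def gateFactor (c p : ℕ) (τ σ : Fin n → Fin 3) (g : Fin n) : ℝ :=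
  (if g ∉ nodeBag bl p then C.weight π g (τ g) else if σ g = τ g then 1 else 0) *
    ((nodeBag bl c).map fun g' =>
      if C.Wire g' g ∧ ¬ WireOK (C.type g') (C.type g) (τ g') (τ g) then (0 : ℝ) else 1).prod

-- The cell of `g` in the parent decides: zero means that `g` is forgotten here and its weight is
-- due; otherwise the two states must agree. Disagreement multiplies by 0 instead of skipping the
-- summand, so the machine can simply run through all pairs of configurations.
open Classical in
theorem run_gateProg {s : Store} {c p i i' : ℕ} {g : Fin n} (hW : WordBounds W n m K)
    (hE : Env T π bl Q W s) (hK : (nodeBag bl c).length ≤ K) (hc : s.ivar 7 = c) (hcm : c ≤ m)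
    (hp : s.ivar 8 = p) (hpm : p ≤ m) (hy : s.ivar 15 = g) (hg : g ∈ nodeBag bl c)
    (hcellc : ∀ g : Fin n, s.iarr 10 (c * n + g) = cellValue bl c i g)
    (hcellp : ∀ g : Fin n, s.iarr 10 (p * n + g) = cellValue bl p i' g) :
    Run W gateProg s (K * 161 + 250) fun s' => s'.rvar 1 = s.rvar 1 *
      gateFactor C π bl c p (decode (nodeBag bl c) i) (decode (nodeBag bl p) i') g := by
  have hcv : ∀ g ∈ nodeBag bl c, s.iarr 10 (c * n + g) = decode (nodeBag bl c) i g + 1 := by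
    intro g hg
    rw [hcellc, cellValue, if_pos hg]
  have hpv : s.iarr 10 (p * n + g) =
      if g ∈ nodeBag bl p then (decode (nodeBag bl p) i' g : ℕ) + 1 else 0 := hcellp g
  have hpv4 : (if g ∈ nodeBag bl p then (decode (nodeBag bl p) i' g : ℕ) + 1 else 0) < 4 := by
    split_ifs <;> omega
  obtain ⟨f1, v1⟩ := fits_stateOf hW hE hc hcm hy (hcv g hg) (by omega)
  obtain ⟨f2, v2⟩ := fits_stateOf hW hE hp hpm hy hpv hpv4
  have h4 := hW.const_lt
  refine Run.mono_time (Run.seq (T' := K * 161 + 13) (R := fun s' => s'.rvar 1 = s.rvar 1 *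
    if g ∉ nodeBag bl p then C.weight π g (decode (nodeBag bl c) i g)
    else if decode (nodeBag bl p) i' g = decode (nodeBag bl c) i g then 1 else 0)
    (Run.mono_time (Run.ite ?_
      (fun hb => Run.mono (run_weightProg hW hE hc hcm hy (hcv g hg)) le_rfl ?_)
      (fun hb => Run.ite ?_ (fun hb' => Run.skip ?_) (fun hb' => Run.rset ?_ ?_)))
      (?_ : _ ≤ 200)) ?_) ?_
  · simp only [BExp.Fits, IExp.Fits, f2, true_and]; omega
  · intro s' h _
    simp only [BExp.Holds, IExp.val, v2] at hb
    have : g ∉ nodeBag bl p := by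
      intro h; simp [h] at hb
    simp only [this, not_false_eq_true, if_true]
    exact h
  · simp only [BExp.Fits, f1, f2, and_self]
  · simp only [BExp.Holds, IExp.val, v1, v2] at hb hb'
    have hgp : g ∈ nodeBag bl p := by
      by_contra h; simp [h] at hb
    simp only [hgp, if_true, Nat.add_right_cancel_iff] at hb'
    simp [hgp, Fin.ext hb']
  · simp [RExp.Fits]
  · simp only [BExp.Holds, IExp.val, v1, v2] at hb hb'
    have hgp : g ∈ nodeBag bl p := by
      by_contra h; simp [h] at hb
    simp only [hgp, if_true, Nat.add_right_cancel_iff, ← Fin.ext_iff] at hb'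
    simp [hgp, hb', RExp.val]
  · simp [BExp.cost, IExp.cost, RExp.cost, stateOf, cell]
  · intro s1 hs1 hF1
    have hE1 : Env T π bl Q W s1 :=
      hE.congr (Agree.of_frame hF1 (by decide) (by decide) (by decide))
    have e7 : s1.ivar 7 = c := by rw [hF1.ivar 7 (by decide), hc]
    have e15 : s1.ivar 15 = g := by rw [hF1.ivar 15 (by decide), hy]
    have e10 : s1.iarr 10 = s.iarr 10 := hF1.iarr 10 (by decide)
    refine Run.mono (Run.bagLoop (L := nodeBag bl) (b := c) (tb := 150) (fun q s' =>
      s'.rvar 1 = s1.rvar 1 * (((nodeBag bl c).take q).map fun g' =>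
        if C.Wire g' g ∧ ¬ WireOK (C.type g') (C.type g) (decode (nodeBag bl c) i g')
          (decode (nodeBag bl c) i g) then (0 : ℝ) else 1).prod)
      hE1.bags hW.n_lt.le hW.m_lt e7 hcm (by decide) (by decide) (by decide) (by decide)
      (by decide) (by decide) (by decide) (by decide) (by decide) ?_ ?_) (by gcongr) ?_
    · intro v v'; simp
    · intro q s2 hq h2 hF2
      have hE2 : Env T π bl Q W (s2.setI 18 (nodeBag bl c)[q]) :=
        (hE1.congr (Agree.of_frame hF2 (by decide) (by decide) (by decide))).congr
          (Agree.setI 9 _ (by decide))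
      have e10' : s2.iarr 10 = s.iarr 10 := by rw [hF2.iarr 10 (by decide), e10]
      refine Run.mono (run_wireProg hW hE2 (c := c) (g := g) (g' := (nodeBag bl c)[q])
        (d := decode (nodeBag bl c) i g) (d' := decode (nodeBag bl c) i (nodeBag bl c)[q])
        ?_ hcm ?_ ?_ ?_ ?_) le_rfl ?_
      · simp [hF2.ivar 7 (by decide), e7]
      · simp [hF2.ivar 15 (by decide), e15]
      · simp
      · simp [e10', hcv g hg]
      · simp [e10', hcv _ (List.getElem_mem hq)]
      · intro s3 h3 _ v
        rw [Store.setI_rvar, h3, Store.setI_rvar, h2]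
        rw [prod_map_take_succ _ _ hq, mul_assoc]
    · intro s2 h2 _
      rw [h2, hs1, gateFactor, List.take_length, mul_assoc]
  · omega

/-- The hypothesis `c ≠ p` matters: decoding the states of `c` must leave those of `p` intact. -/
theorem run_summandProg {s : Store} {c p i i' : ℕ} (hW : WordBounds W n m K)
    (hE : Env T π bl Q W s) (hbl : T.ListsBags bl) (hK : (nodeBag bl c).length ≤ K)
    (hcp : c ≠ p)
    (hc : s.ivar 7 = c) (hcm : c ≤ m) (hp : s.ivar 8 = p) (hpm : p ≤ m)
    (hi : s.ivar 11 = i) (hiK : i < 3 ^ K) (hC : Clean bl s)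
    (hcellp : ∀ g : Fin n, s.iarr 10 (p * n + g) = cellValue bl p i' g) :
    Run W summandProg s (K * (K * 161 + 291) + 60) fun s' => (Clean bl s' ∧
      ∀ g : Fin n, s'.iarr 10 (p * n + g) = cellValue bl p i' g) ∧
      s'.rvar 2 = s.rvar 2 + s.rarr 1 (i * (m + 1) + c) * ((nodeBag bl c).map
        (gateFactor C π bl c p (decode (nodeBag bl c) i) (decode (nodeBag bl p) i'))).prod := by
  have hiW : i < W := hiK.trans hW.pow_lt
  have hlt := (mul_add_lt hiK (show c < m + 1 by omega)).trans hW.table_lt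
  have hmW := hW.m_lt
  refine Run.mono_time (Run.seq_wp (Run.iset (by simp [IExp.Fits, hi]; omega)
    (Run.seq (run_decodeProg hW (hE.congr (Agree.setI 9 s (by decide))).bags hbl hK (bx := 7)
      (b := c) (i := i) hC (by simp) (by simp [hc]) hcm (by simp [IExp.val, hi]) hiW) ?_)))
    -- The 291 in the bound is 261 for multiplying in a gate, apart from its wire checks, plus 30
    -- for decoding it.
    (?_ : 2 + (K * 30 + 13 + (10 + (K * (K * 161 + 261) + 13 + 4))) ≤ _)
  · rintro s1 ⟨hC1, hc1, hp1⟩ hF1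
    have hE1 : Env T π bl Q W s1 := (hE.congr (Agree.setI 9 s (by decide))).congr
      (Agree.of_frame hF1 (by decide) (by decide) (by decide))
    have e7 : s1.ivar 7 = c := by rw [hF1.ivar 7 (by decide)]; simp [hc]
    have e8 : s1.ivar 8 = p := by rw [hF1.ivar 8 (by decide)]; simp [hp]
    have e11 : s1.ivar 11 = i := by rw [hF1.ivar 11 (by decide)]; simp [hi]
    have er : s1.rarr 1 = s.rarr 1 := by rw [hF1.rarr 1 (by decide)]; simp
    have e2 : s1.rvar 2 = s.rvar 2 := by rw [hF1.rvar 2 (by decide)]; simp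
    have hp1' : ∀ g : Fin n, s1.iarr 10 (p * n + g) = cellValue bl p i' g := by
      intro g
      rw [hp1 p hcp.symm g]
      simpa using hcellp g
    refine Run.mono_time (Run.seq_wp (Run.rset ?_ (Run.seq (T' := 4) (Run.bagLoop (L := nodeBag bl)
      (b := c) (tb := K * 161 + 250) (fun q s' =>
      s'.rvar 1 = s.rarr 1 (i * (m + 1) + c) * (((nodeBag bl c).take q).map
        (gateFactor C π bl c p (decode (nodeBag bl c) i) (decode (nodeBag bl p) i'))).prod)
      (hE1.congr (Agree.setR 9 _)).bags hW.n_lt.le hW.m_lt (by simp [e7]) hcm (by decide)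
      (by decide) (by decide) (by decide)
      (by decide) (by decide) (by decide) (by decide) (by decide) ?_ ?_) ?_)))
      ?_
    · simp only [RExp.Fits, IExp.Fits, IExp.val, e11, hE1.bags.m1_eq, e7]
      have : i * (m + 1) < W := by omega
      omega
    · intro v v'
      simp [RExp.val, IExp.val, e11, hE1.bags.m1_eq, e7, er]
    · intro q s2 hq h2 hF2
      have hE2 : Env T π bl Q W (s2.setI 15 (nodeBag bl c)[q]) :=
        ((hE1.congr (Agree.setR 9 _)).congr
          (Agree.of_frame hF2 (by decide) (by decide) (by decide))).congr
          (Agree.setI 9 _ (by decide))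
      have e10 : s2.iarr 10 = s1.iarr 10 := by rw [hF2.iarr 10 (by decide)]; simp
      refine Run.mono (run_gateProg hW hE2 (c := c) (p := p) (i := i) (i' := i')
        (g := (nodeBag bl c)[q]) hK ?_ hcm ?_ hpm ?_ (List.getElem_mem hq) ?_ ?_) le_rfl ?_
      · simp [hF2.ivar 7 (by decide), e7]
      · simp [hF2.ivar 8 (by decide), e8]
      · simp
      · simpa [e10] using hc1
      · simpa [e10] using hp1'
      · intro s3 h3 _ v
        rw [Store.setI_rvar, h3, Store.setI_rvar, h2]
        rw [prod_map_take_succ _ _ hq, mul_assoc]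
    · intro s2 h2 hF2
      have e10 : s2.iarr 10 = s1.iarr 10 := by rw [hF2.iarr 10 (by decide)]; simp
      have e22 : s2.rvar 2 = s.rvar 2 := by rw [hF2.rvar 2 (by decide)]; simp [e2]
      refine Run.rset (by simp [RExp.Fits]) ⟨⟨?_, ?_⟩, ?_⟩
      · intro b hb g hg
        simpa [e10] using hC1 b hb g hg
      · simpa [e10] using hp1'
      · simp only [RExp.val, Store.setR_rvar, if_true, e22, h2, List.take_length]
    · have := Nat.mul_le_mul_right (K * 161 + 250 + 11) hK
      simp only [RExp.cost, IExp.cost, Nat.add_assoc, Nat.reduceAdd] at this ⊢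
      omega
  · ring_nf; omega

end

/-! ### Messages, tables and the final value -/

section

variable {n m : ℕ} {C : Circuit (Fin n)} {T : TreeDecomposition C (Fin m)}
  {π : C.Var → unitInterval} {bl : Fin m → List (Fin n)} {Q : ℕ → ℕ} {W K : ℕ}

variable (π) in
/-- The sum of the summands is the message. -/
theorem sum_gateFactor (hbl : T.ListsBags bl) (c p : ℕ) (F : (Fin n → Fin 3) → ℝ)
    (σ : Fin n → Fin 3) :
    ∑ i ∈ Finset.range (3 ^ (nodeBag bl c).length), F (decode (nodeBag bl c) i) *
      ((nodeBag bl c).map (gateFactor C π bl c p (decode (nodeBag bl c) i) σ)).prod =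
    msg (fun b => (nodeBag bl b).toFinset) (C.weight π) (bagOK C bl) c p F σ := by
  classical
  have hnd := nodeBag_nodup hbl c
  rw [sum_decode hnd fun τ => F τ * ((nodeBag bl c).map (gateFactor C π bl c p τ σ)).prod]
  unfold msg
  dsimp only
  simp only [List.mem_toFinset]
  rw [← Finset.filter_filter, Finset.sum_filter (p := fun τ : Fin n → Fin 3 =>
    ∀ g ∈ nodeBag bl c, g ∈ nodeBag bl p → τ g = σ g)]
  refine Finset.sum_congr rfl fun τ _ => ?_
  rw [← List.prod_toFinset _ hnd]
  unfold gateFactor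
  rw [Finset.prod_mul_distrib]
  have h1 : ∏ g ∈ (nodeBag bl c).toFinset, ((nodeBag bl c).map fun g' =>
      if C.Wire g' g ∧ ¬ WireOK (C.type g') (C.type g) (τ g') (τ g) then (0 : ℝ) else 1).prod =
      bagOK C bl c τ := by
    unfold bagOK
    refine Finset.prod_congr rfl fun g _ => ?_
    rw [← List.prod_toFinset _ hnd]
  rw [h1]
  -- If `τ` and `σ` agree on the common gates, these contribute factors 1 and only the weights of
  -- forgotten gates remain. Otherwise one factor is 0.
  split_ifs with h
  · congr 2
    rw [← Finset.prod_subset (Finset.sdiff_subset (t := (nodeBag bl p).toFinset))]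
    · refine Finset.prod_congr rfl fun g hg => ?_
      simp only [Finset.mem_sdiff, List.mem_toFinset] at hg
      rw [if_pos hg.2]
    · intro g hg hg'
      simp only [Finset.mem_sdiff, List.mem_toFinset, not_and, not_not] at hg hg'
      rw [if_neg (not_not.2 (hg' hg)), if_pos (h g hg (hg' hg)).symm]
  · push Not at h
    obtain ⟨g, hg, hgp, hne⟩ := h
    rw [Finset.prod_eq_zero (i := g) (by simpa using hg)]
    · ring
    · rw [if_neg (not_not.2 hgp), if_neg (Ne.symm hne)]

/-- `F` is the table of the child, which is only read here. The single cell written belongs to the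
parent. -/
theorem run_entryProg {s : Store} {c p i' : ℕ} (hW : WordBounds W n m K)
    (hE : Env T π bl Q W s) (hbl : T.ListsBags bl) (hK : ∀ b, (nodeBag bl b).length ≤ K)
    (hcp : c ≠ p) (hc : s.ivar 7 = c) (hcm : c ≤ m) (hp : s.ivar 8 = p) (hpm : p ≤ m)
    (hi' : s.ivar 9 = i') (hi'K : i' < 3 ^ (nodeBag bl p).length)
    (hsz : s.ivar 12 = 3 ^ (nodeBag bl c).length) (hC : Clean bl s)
    (F : (Fin n → Fin 3) → ℝ) (hF : ∀ i < 3 ^ (nodeBag bl c).length,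
      s.rarr 1 (i * (m + 1) + c) = F (decode (nodeBag bl c) i)) :
    Run W entryProg s (3 ^ K * (K * (K * 161 + 291) + 68) + K * 30 + 50) fun s' => Clean bl s' ∧
      s'.rarr 1 = Function.update (s.rarr 1) (i' * (m + 1) + p) (s.rarr 1 (i' * (m + 1) + p) *
        msg (fun b => (nodeBag bl b).toFinset) (C.weight π) (bagOK C bl) c p F
          (decode (nodeBag bl p) i')) := by
  have hpowc : 3 ^ (nodeBag bl c).length ≤ 3 ^ K := Nat.pow_le_pow_right (by norm_num) (hK c)
  have hpowp : 3 ^ (nodeBag bl p).length ≤ 3 ^ K := Nat.pow_le_pow_right (by norm_num) (hK p)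
  have hKW := hW.pow_lt
  have hmW := hW.m_lt
  have h4W := hW.const_lt
  have hlt := (mul_add_lt (hi'K.trans_le hpowp) (show p < m + 1 by omega)).trans hW.table_lt
  refine Run.mono_time (Run.seq_wp (Run.iset (by simp [IExp.Fits, hi']; omega)
    (Run.seq (T' := 2 + (2 + (3 ^ (nodeBag bl c).length * (K * (K * 161 + 291) + 60 + 8) + 4 + 20)))
      (run_decodeProg hW (hE.congr (Agree.setI 9 s (by decide))).bags hbl (hK p) (bx := 8)
      (b := p) (i := i') hC (by simp) (by simp [hp]) hpm (by simp [IExp.val, hi']) (by omega))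
      ?_))) ?_
  · rintro s1 ⟨hC1, hc1, _⟩ hF1
    have hE1 : Env T π bl Q W s1 := (hE.congr (Agree.setI 9 s (by decide))).congr
      (Agree.of_frame hF1 (by decide) (by decide) (by decide))
    have e7 : s1.ivar 7 = c := by rw [hF1.ivar 7 (by decide)]; simp [hc]
    have e8 : s1.ivar 8 = p := by rw [hF1.ivar 8 (by decide)]; simp [hp]
    have e9 : s1.ivar 9 = i' := by rw [hF1.ivar 9 (by decide)]; simp [hi']
    have e12 : s1.ivar 12 = 3 ^ (nodeBag bl c).length := by
      rw [hF1.ivar 12 (by decide)]; simp [hsz]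
    have er : s1.rarr 1 = s.rarr 1 := by rw [hF1.rarr 1 (by decide)]; simp
    refine Run.mono_time (Run.seq_wp (Run.rset (by simp [RExp.Fits]) (Run.seq_wp (Run.iset
      (by simp [IExp.Fits]; omega) (Run.seq (T' := 20) (Run.forLoop (lo := 0)
      (N := 3 ^ (nodeBag bl c).length) (tb := K * (K * 161 + 291) + 60) (fun j s' => (Clean bl s' ∧
        ∀ g : Fin n, s'.iarr 10 (p * n + g) = cellValue bl p i' g) ∧
        s'.rvar 2 = ∑ i ∈ Finset.range j, F (decode (nodeBag bl c) i) * ((nodeBag bl c).map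
          (gateFactor C π bl c p (decode (nodeBag bl c) i) (decode (nodeBag bl p) i'))).prod)
      ?_ ?_ ?_ ?_ ?_ ?_ ?_ ?_ ?_ ?_) ?_))))) ?_
    · simp [IExp.val]
    · simp [e12]
    · omega
    · simp [e12]; omega
    · omega
    · decide
    · decide
    · decide
    · refine ⟨⟨fun b hb g hg => ?_, fun g => ?_⟩, ?_⟩
      · simpa using hC1 b hb g hg
      · simpa using hc1 g
      · simp [RExp.val]
    · rintro j s2 hj ⟨⟨hC2, hc2⟩, h2⟩ hF2 hx2
      simp only [Nat.zero_add] at hx2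
      have hE2 : Env T π bl Q W s2 := ((hE1.congr (Agree.setR 9 s1)).congr
        (Agree.setI 9 _ (by decide))).congr
        (Agree.of_frame hF2 (by decide) (by decide) (by decide))
      have er2 : s2.rarr 1 = s.rarr 1 := by rw [hF2.rarr 1 (by decide)]; simp [er]
      refine Run.mono (run_summandProg hW hE2 hbl (hK c) hcp ?_ hcm ?_ hpm hx2 (by omega) hC2 hc2)
        le_rfl ?_
      · rw [hF2.ivar 7 (by decide)]; simp [e7]
      · rw [hF2.ivar 8 (by decide)]; simp [e8]
      · rintro s3 ⟨⟨hC3, hc3⟩, h3⟩ _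
        refine ⟨⟨fun b hb g hg => ?_, fun g => ?_⟩, ?_⟩
        · simpa using hC3 b hb g hg
        · simpa using hc3 g
        · rw [Store.setI_rvar, h3, h2, Finset.sum_range_succ, er2, hF j hj]
    · rintro s2 ⟨⟨hC2, _⟩, h2⟩ hF2
      have er2 : s2.rarr 1 = s.rarr 1 := by rw [hF2.rarr 1 (by decide)]; simp [er]
      have e5 : s2.ivar 5 = m + 1 := by rw [hF2.ivar 5 (by decide)]; simpa using hE1.bags.m1_eq
      have e8' : s2.ivar 8 = p := by rw [hF2.ivar 8 (by decide)]; simp [e8]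
      have e9' : s2.ivar 9 = i' := by rw [hF2.ivar 9 (by decide)]; simp [e9]
      have hfit : (IExp.add (.mul (.var 9) (.var 5)) (.var 8)).Fits W s2 := by
        simp only [IExp.Fits, IExp.val, e5, e8', e9']
        omega
      refine Run.mono_time (Run.rput hfit ⟨hfit, trivial⟩ ⟨?_, ?_⟩) (by simp [IExp.cost, RExp.cost])
      · intro b hb g hg
        simpa using hC2 b hb g hg
      · simp only [Store.putR_rarr, if_true, IExp.val, RExp.val, e5, e8', e9', er2, h2]
        rw [sum_gateFactor π hbl]
    · simp only [RExp.cost, IExp.cost]; omega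
  · have := Nat.mul_le_mul_right (K * (K * 161 + 291) + 68) hpowc
    simp only [IExp.cost, Nat.add_assoc, Nat.reduceAdd] at this ⊢
    omega

/-- The tables after `t` messages are in the store. -/
def HoldsTables (T : TreeDecomposition C (Fin m)) (π : C.Var → unitInterval)
    (bl : Fin m → List (Fin n)) (Q : ℕ → ℕ) (t : ℕ) (s : Store) : Prop :=
  ∀ b ≤ m, ∀ i < 3 ^ (nodeBag bl b).length,
    s.rarr 1 (i * (m + 1) + b) = nodeTables C bl T π Q t b (decode (nodeBag bl b) i)

theorem run_nodeProg {s : Store} {t : ℕ} (hW : WordBounds W n m K)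
    (hE : Env T π bl Q W s) (hbl : T.ListsBags bl) (hK : ∀ b, (nodeBag bl b).length ≤ K)
    (ht : s.ivar 6 = t) (htm : t < m) (hQ : Q t < m) (hne : Q t ≠ nodeParent T (Q t))
    (hC : Clean bl s) (hT : HoldsTables T π bl Q t s) :
    Run W nodeProg s
      (3 ^ K * (3 ^ K * (K * (K * 161 + 291) + 68) + K * 30 + 58) + 30) fun s' =>
      Clean bl s' ∧ HoldsTables T π bl Q (t + 1) s' := by
  set c := Q t with hcdef
  set p := nodeParent T c with hpdef
  have hpm : p ≤ m := nodeParent_le T c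
  have hpowc : 3 ^ (nodeBag bl c).length ≤ 3 ^ K := Nat.pow_le_pow_right (by norm_num) (hK c)
  have hpowp : 3 ^ (nodeBag bl p).length ≤ 3 ^ K := Nat.pow_le_pow_right (by norm_num) (hK p)
  have hKW := hW.pow_lt
  have hmW := hW.m_lt
  have h4W := hW.const_lt
  have hpass : ∀ b σ, nodeTables C bl T π Q (t + 1) b σ = if b = p then
      nodeTables C bl T π Q t b σ * msg (fun b => (nodeBag bl b).toFinset) (C.weight π)
        (bagOK C bl) c p (nodeTables C bl T π Q t c) σ else nodeTables C bl T π Q t b σ :=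
    fun b σ => rfl
  have e8 : s.iarr 8 t = c := by rw [hE.queue]
  have e3 := hE.par c hQ
  have e9p := hE.size p hpm
  have e9c := hE.size c hQ.le
  -- The parent's table is updated in place: after `j` rounds its entries below `j` are new and the
  -- rest are old. This is sound because the message reads only the child's table and each parent
  -- entry is multiplied once.
  refine Run.mono_time (Run.seq_wp (Run.iset ?_ (Run.seq_wp (Run.iset ?_ (Run.seq_wp (Run.iset ?_
    (Run.seq_wp (Run.iset ?_ (Run.seq_wp (Run.iset ?_ (Run.mono (Run.forLoop (lo := 0)
      (N := 3 ^ (nodeBag bl p).length)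
      (tb := 3 ^ K * (K * (K * 161 + 291) + 68) + K * 30 + 50) (fun j s' => Clean bl s' ∧
        ∀ b ≤ m, ∀ i < 3 ^ (nodeBag bl b).length, s'.rarr 1 (i * (m + 1) + b) =
          if b = p ∧ j ≤ i then nodeTables C bl T π Q t b (decode (nodeBag bl b) i)
          else nodeTables C bl T π Q (t + 1) b (decode (nodeBag bl b) i))
      ?_ ?_ ?_ ?_ ?_ ?_ ?_ ?_ ?_ ?_) le_rfl ?_))))))))))) ?_
  · simp [IExp.Fits, IExp.val, ht, e8]; omega
  · simp [IExp.Fits, IExp.val, ht, e8, e3]; omega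
  · simp [IExp.Fits, IExp.val, ht, e8, e3, ← hpdef, e9p]; omega
  · simp [IExp.Fits, IExp.val, ht, e8, e9c]; omega
  · simp [IExp.Fits]; omega
  · simp [IExp.val]
  · simp [IExp.val, ht, e8, e3, ← hpdef, e9p]
  · omega
  · simp [IExp.val, ht, e8, e3, ← hpdef, e9p]; omega
  · omega
  · decide
  · decide
  · decide
  · refine ⟨fun b hb g hg => ?_, fun b hb i hi => ?_⟩
    · simpa using hC b hb g hg
    · simp only [Store.setI_rarr, hT b hb i hi, Nat.zero_le, and_true, hpass]
      split_ifs <;> rfl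
  · rintro j s1 hj ⟨hC1, hT1⟩ hF1 hx1
    simp only [Nat.zero_add] at hx1
    have hE1 : Env T π bl Q W s1 := (((((hE.congr (Agree.setI 9 _ (by decide))).congr
      (Agree.setI 9 _ (by decide))).congr (Agree.setI 9 _ (by decide))).congr
      (Agree.setI 9 _ (by decide))).congr (Agree.setI 9 _ (by decide))).congr
      (Agree.of_frame hF1 (by decide) (by decide) (by decide))
    refine Run.mono (run_entryProg hW hE1 hbl hK (c := c) (p := p) hne ?_ hQ.le ?_ hpm hx1 hj ?_
      hC1 (nodeTables C bl T π Q t c) ?_) le_rfl ?_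
    · rw [hF1.ivar 7 (by decide)]; simp [IExp.val, ht, e8]
    · rw [hF1.ivar 8 (by decide)]; simp [IExp.val, ht, e8, e3, ← hpdef]
    · rw [hF1.ivar 12 (by decide)]; simp [IExp.val, ht, e8, e9c]
    · intro i hi
      rw [hT1 c hQ.le i hi, if_neg (fun h => hne h.1), hpass, if_neg hne]
    · rintro s2 ⟨hC2, hT2⟩ _
      refine ⟨fun b hb g hg => ?_, fun b hb i hi => ?_⟩
      · simpa using hC2 b hb g hg
      · rw [Store.setI_rarr, hT2]
        by_cases h : b = p ∧ i = j
        · obtain ⟨rfl, rfl⟩ := h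
          rw [Function.update_self, hT1 _ hb i hi, if_pos ⟨rfl, le_rfl⟩,
            if_neg (by omega), hpass, if_pos rfl]
        · rw [Function.update_of_ne, hT1 b hb i hi]
          · refine if_congr ?_ rfl rfl
            omega
          · intro h'
            have := mul_add_inj (show b < m + 1 by omega) (show p < m + 1 by omega) h'
            exact h ⟨this.2, this.1⟩
  · rintro s1 ⟨hC1, hT1⟩ _
    refine ⟨hC1, fun b hb i hi => ?_⟩
    rw [hT1 b hb i hi, if_neg]
    rintro ⟨rfl, h⟩
    omega
  · have := Nat.mul_le_mul_right (3 ^ K * (K * (K * 161 + 291) + 68) + K * 30 + 58) hpowp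
    simp only [IExp.cost, Nat.add_assoc, Nat.reduceAdd] at this ⊢
    omega

theorem run_tableProg {s : Store} (hW : WordBounds W n m K)
    (hE : Env T π bl Q W s) (hbl : T.ListsBags bl) (hK : ∀ b, (nodeBag bl b).length ≤ K)
    (hQ : IsOrder m (nodeParent T) Q) (hC : Clean bl s)
    (hone : ∀ b ≤ m, ∀ i < 3 ^ (nodeBag bl b).length, s.rarr 1 (i * (m + 1) + b) = 1) :
    Run W tableProg s
      (m * (3 ^ K * (3 ^ K * (K * (K * 161 + 291) + 68) + K * 30 + 58) + 38) + 20) fun s' =>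
      s'.rvar 0 = C.prob π := by
  have hmW := hW.m_lt
  obtain ⟨dep, hdep⟩ := exists_depth T
  refine Run.mono_time (Run.seq_wp (Run.iset (by simp [IExp.Fits]; omega) (Run.seq (T' := 10)
    (Run.forLoop (lo := 0) (N := m)
      (tb := 3 ^ K * (3 ^ K * (K * (K * 161 + 291) + 68) + K * 30 + 58) + 30)
      (fun t s' => Clean bl s' ∧ HoldsTables T π bl Q t s')
      ?_ ?_ ?_ ?_ ?_ ?_ ?_ ?_ ?_ ?_) ?_))) ?_
  · simp [IExp.val]
  · simp [hE.bags.m_eq]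
  · omega
  · simp [hE.bags.m_eq]; omega
  · omega
  · decide
  · decide
  · decide
  · exact ⟨fun b hb g hg => by simpa using hC b hb g hg, fun b hb i hi => hone b hb i hi⟩
  · rintro t s1 ht ⟨hC1, hT1⟩ hF1 hx1
    simp only [Nat.zero_add] at hx1
    have hE1 : Env T π bl Q W s1 := (hE.congr (Agree.setI 9 _ (by decide))).congr
      (Agree.of_frame hF1 (by decide) (by decide) (by decide))
    refine Run.mono (run_nodeProg hW hE1 hbl hK hx1 ht (hQ.lt t ht) ?_ hC1 hT1) le_rfl ?_
    · intro h
      have := hdep (Q t) (hQ.lt t ht)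
      rw [← h] at this
      omega
    · rintro s2 ⟨hC2, hT2⟩ _
      exact ⟨fun b hb g hg => by simpa using hC2 b hb g hg, fun b hb i hi => hT2 b hb i hi⟩
  · rintro s1 ⟨_, hT1⟩ hF1
    have e3 : s1.ivar 3 = m := by rw [hF1.ivar 3 (by decide)]; simpa using hE.bags.m_eq
    refine Run.mono_time (Run.rset ?_ ?_) (by simp [RExp.cost, IExp.cost])
    · simp [RExp.Fits, IExp.Fits, e3]; omega
    · have h := hT1 m le_rfl 0 (by positivity)
      have h0 : decode (nodeBag bl m) 0 = 0 := by
        funext g; simp [decode, nodeBag]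
      rw [Nat.zero_mul, Nat.zero_add, h0, nodeTables_root C bl π hbl hQ] at h
      simp [RExp.val, IExp.val, e3, h]
  · simp only [IExp.cost, Nat.add_assoc, Nat.reduceAdd]
    omega

end

/-! ### The input -/

/-- Set the register 5 to the number of nodes plus one, and let the root have the virtual node as
its parent. -/
def initProg : Prog :=
  .seq (.iset 5 (.add (.var 3) (.lit 1))) (.iput 3 (.var 4) (.var 3))

/-- The program that computes the probability of a circuit. -/
def mainProg : Prog :=
  .seq initProg (.seq adjProg (.seq countProg (.seq leavesProg (.seq queueProg
    (.seq sizeProg tableProg)))))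

section

variable {n m : ℕ} (bl : Fin m → List (Fin n))

theorem bagOffset_succ {b : ℕ} (hb : b < m) :
    bagOffset bl (b + 1) = bagOffset bl b + (bl ⟨b, hb⟩).length := by
  unfold bagOffset
  have : b < (List.finRange m).length := by simpa using hb
  rw [List.take_succ_eq_append_getElem this]
  simp

theorem bagOffset_le {K : ℕ} (hK : ∀ b, (bl b).length ≤ K) (j : ℕ) : bagOffset bl j ≤ m * K := by
  unfold bagOffset
  rw [List.length_flatMap]
  refine (List.sum_le_card_nsmul _ K ?_).trans ?_
  · intro x hx
    obtain ⟨b, _, rfl⟩ := List.mem_map.1 hx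
    exact hK b
  · simp only [List.length_map, smul_eq_mul]
    refine Nat.mul_le_mul_right K ?_
    simp

theorem getD_bags {b : ℕ} (hb : b < m) {q : ℕ} (hq : q < (bl ⟨b, hb⟩).length) :
    (((List.finRange m).flatMap bl).map fun g => (g : ℕ)).getD (bagOffset bl b + q) 0 =
      (bl ⟨b, hb⟩)[q] := by
  have hb' : b < (List.finRange m).length := by simpa using hb
  have h1 : (List.finRange m).flatMap bl = ((List.finRange m).take b).flatMap bl ++
      (bl ⟨b, hb⟩ ++ ((List.finRange m).drop (b + 1)).flatMap bl) := by
    conv_lhs => rw [← List.take_append_drop b (List.finRange m), List.drop_eq_getElem_cons hb']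
    simp
  have hcoe : ∀ l : List (Fin n), (l.map fun g => (g : ℕ)) = l.map Fin.val := by
    intro l
    simp [← List.map_eq_flatMap]
  rw [h1, hcoe, List.map_append, List.getD_append_right _ _ _ _ (by simp [bagOffset])]
  simp only [List.length_map, bagOffset, Nat.add_sub_cancel_left, List.map_append]
  rw [List.getD_append _ _ _ _ (by simpa using hq), List.getD_eq_getElem _ _ (by simpa using hq)]
  simp

end

/-! ### Sizes of the input and correctness of the whole program -/

section

variable {n m : ℕ} {C : Circuit (Fin n)} {T : TreeDecomposition C (Fin m)}

theorem card_bag_le (b : Fin m) : (T.bag b).card ≤ T.width + 1 := by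
  have h2 := Finset.le_sup (f := fun b => (T.bag b).card) (Finset.mem_univ b)
  unfold TreeDecomposition.width
  omega

-- Every gate lies in a bag. With the analogous count of wires, this allows all running times to be
-- expressed through the number of nodes and the width.
variable (T) in
theorem card_gates_le : n ≤ m * (T.width + 1) := by
  have h : (Finset.univ : Finset (Fin n)) ⊆ Finset.univ.biUnion T.bag := by
    intro g _
    obtain ⟨⟨b, hb⟩⟩ := (T.connected g).nonempty
    exact Finset.mem_biUnion.2 ⟨b, Finset.mem_univ _, hb⟩
  have := (Finset.card_le_card h).trans
    (Finset.card_biUnion_le_card_mul _ _ _ fun b _ => card_bag_le b)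
  simpa using this

variable (T) in
theorem length_wires_le {ws : List (Fin n × Fin n)} (hws : C.ListsWires ws) :
    ws.length ≤ m * (T.width + 1) ^ 2 := by
  have h : ws.toFinset ⊆ Finset.univ.biUnion fun b => T.bag b ×ˢ T.bag b := by
    rintro ⟨g', g⟩ hw
    obtain ⟨b, h1, h2⟩ := T.wire_covered g' g ((hws.2 g' g).1 (List.mem_toFinset.1 hw))
    exact Finset.mem_biUnion.2 ⟨b, Finset.mem_univ _, Finset.mem_product.2 ⟨h1, h2⟩⟩
  have := (Finset.card_le_card h).trans
    (Finset.card_biUnion_le_card_mul _ _ ((T.width + 1) ^ 2) fun b _ => by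
      rw [Finset.card_product, pow_two]
      exact Nat.mul_le_mul (card_bag_le b) (card_bag_le b))
  rw [List.toFinset_card_of_nodup hws.1] at this
  simpa using this

theorem run_mainProg {W K : ℕ} {π : C.Var → unitInterval} {ws : List (Fin n × Fin n)}
    {bl : Fin m → List (Fin n)} (hW : WordBounds W n m K) (hmW : m + 2 < W)
    (hwW : ws.length < W) (hoffW : m * K < W) (hws : C.ListsWires ws) (hbl : T.ListsBags bl)
    (hK : T.width + 1 = K) :
    Run W mainProg (inputStore C T π ws bl) (7 + ((ws.length * 17 + 6) + ((m * 17 + 6) +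
      (((m + 1) * 21 + 8) + ((m * 33 + 6) + (((m + 1) * (K * 15 + 3 ^ K * 16 + 36) + 6) +
      (m * (3 ^ K * (3 ^ K * (K * (K * 161 + 291) + 68) + K * 30 + 58) + 38) + 20)))))))
      fun s => s.rvar 0 = C.prob π := by
  classical
  have hKb : ∀ b, (nodeBag bl b).length ≤ K := fun b => hK ▸ nodeBag_length_le hbl b
  have hKbl : ∀ b, (bl b).length ≤ K := by
    intro b
    simpa [nodeBag] using hKb b
  obtain ⟨dep, hdep⟩ := exists_depth T
  have hpar : ∀ b < m, nodeParent T b ≤ m := fun b _ => nodeParent_le T b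
  have h4W := hW.const_lt
  have hm1 := hW.m_lt
  have hroot := T.root.2
  set s0 := inputStore C T π ws bl with hs0
  refine Run.seq (R := fun s1 => s1 = (s0.setI 5 (m + 1)).putI 3 T.root m)
    (Run.mono_time (Run.seq_wp (Run.iset ?_ (Run.iput ?_ ?_ ?_))) (by simp [IExp.cost])) ?_
  · simp [IExp.Fits, IExp.val, hs0, inputStore]; omega
  · simp [IExp.Fits, hs0, inputStore]; omega
  · simp [IExp.Fits, hs0, inputStore]; omega
  · simp [IExp.val, hs0, inputStore]
  intro s1 hs1 _
  have i0 : s1.ivar 0 = n := by simp [hs1, hs0, inputStore]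
  have i1 : s1.ivar 1 = C.output := by simp [hs1, hs0, inputStore]
  have i2 : s1.ivar 2 = ws.length := by simp [hs1, hs0, inputStore]
  have i3 : s1.ivar 3 = m := by simp [hs1, hs0, inputStore]
  have i5 : s1.ivar 5 = m + 1 := by simp [hs1]
  have a0 : ∀ g : Fin n, s1.iarr 0 g = (C.type g).code := by
    intro g; simp [hs1, hs0, inputStore]
  have a1 : ∀ j (h : j < ws.length), s1.iarr 1 j = ws[j].1 := by
    intro j hj; simp [hs1, hs0, inputStore, hj]
  have a2 : ∀ j (h : j < ws.length), s1.iarr 2 j = ws[j].2 := by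
    intro j hj; simp [hs1, hs0, inputStore, hj]
  have a3 : ∀ b < m, s1.iarr 3 b = nodeParent T b := by
    intro b hb
    by_cases h : b = T.root
    · simp [hs1, h, nodeParent]
    · have h' : (⟨b, hb⟩ : Fin m) ≠ T.root := fun e => h (by rw [← e])
      simp [hs1, hs0, inputStore, nodeParent, Function.update_of_ne h, hb, h']
  have a4 : ∀ b, s1.iarr 4 b = if b ≤ m then bagOffset bl b else 0 := by
    intro b; simp [hs1, hs0, inputStore]
  have a5 : ∀ j, s1.iarr 5 j =
      (((List.finRange m).flatMap bl).map fun g => (g : ℕ)).getD j 0 := by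
    intro j; simp [hs1, hs0, inputStore]
  have a6 : ∀ j, s1.iarr 6 j = 0 := by intro j; simp [hs1, hs0, inputStore]
  have a7 : ∀ j, s1.iarr 7 j = 0 := by intro j; simp [hs1, hs0, inputStore]
  have a10 : ∀ j, s1.iarr 10 j = 0 := by intro j; simp [hs1, hs0, inputStore]
  have r0 : ∀ g : Fin n, C.type g = GateType.var → s1.rarr 0 g = C.gateProb π g := by
    intro g hg; simp [hs1, hs0, inputStore, Circuit.gateProb, hg]
  have hbags : HoldsBags W n m (nodeBag bl) s1 := by
    refine ⟨i0, i3, i5, fun b _ => ?_, fun b hb => ?_, fun b hb q hq => ?_⟩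
    · rw [a4]
      have := bagOffset_le bl hKbl b
      split_ifs <;> omega
    · rw [a4, a4, if_pos hb]
      rcases hb.lt_or_eq with h | rfl
      · rw [if_pos (show b + 1 ≤ m from h), bagOffset_succ bl h]
        simp [nodeBag, h]
      -- Beyond the last offset, array 4 holds 0, so truncated subtraction gives the virtual node
      -- length 0.
      · simp [nodeBag]
    · have h : b < m := by
        by_contra h
        simp [nodeBag, h] at hq
      have hq' : q < (bl ⟨b, h⟩).length := by simpa [nodeBag, h] using hq
      rw [a4, if_pos hb, a5, getD_bags bl h hq']
      simp [nodeBag, h]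
  refine Run.seq (run_adjProg i0 i2 a1 a2 a6 hW.n_lt hW.nn_lt hwW (by omega)) ?_
  intro s2 h2 F2
  have A2 : Agree 5 s1 s2 := Agree.of_frame F2 (by decide) (by decide) (by decide)
  refine Run.seq (run_countProg (par := nodeParent T) ((A2.ivar 3 (by norm_num)).trans i3)
    (fun b hb => by rw [A2.iarr 3 (by norm_num), a3 b hb]) hpar
    (fun j => by rw [F2.iarr 7 (by decide), a7]) hm1) ?_
  intro s3 h3 F3
  have A3 : Agree 5 s1 s3 := A2.trans (Agree.of_frame F3 (by decide) (by decide) (by decide))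
  refine Run.seq (run_leavesProg ((A3.ivar 5 (by norm_num)).trans i5) h3 hmW) ?_
  intro s4 h4 F4
  have A4 : Agree 5 s1 s4 := A3.trans (Agree.of_frame F4 (by decide) (by decide) (by decide))
  refine Run.seq (run_queueProg ((A4.ivar 3 (by norm_num)).trans i3)
    (fun b hb => by rw [A4.iarr 3 (by norm_num), a3 b hb]) hpar hdep h4 hmW) ?_
  intro s5 h5 F5
  have A5 : Agree 5 s1 s5 := A4.trans (Agree.of_frame F5 (by decide) (by decide) (by decide))
  refine Run.seq (run_sizeProg (hbags.congr le_rfl A5) hKb hW.n_lt hm1 (by omega) hW.pow_lt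
    hW.table_lt) ?_
  intro s6 h6 F6
  have A6 : Agree 5 s1 s6 := A5.trans (Agree.of_frame F6 (by decide) (by decide) (by decide))
  refine run_tableProg (T := T) (π := π) (Q := s5.iarr 8) hW ⟨hbags.congr le_rfl A6, ?_, ?_, ?_,
    ?_, ?_, ?_, fun b hb => (h6 b hb).1⟩ hbl hKb h5 ?_ fun b hb => (h6 b hb).2
  · rw [A6.ivar 1 (by norm_num), i1]
  · rw [A6.iarr 0 (by norm_num)]; exact a0
  · rw [A6.rarr]; exact r0
  · rw [A6.iarr 3 (by norm_num)]; exact a3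
  · rw [F6.iarr 6 (by decide), F5.iarr 6 (by decide), F4.iarr 6 (by decide),
      F3.iarr 6 (by decide)]
    intro g' g
    rw [h2 g' g]
    exact if_congr (hws.2 g' g) rfl rfl
  · exact F6.iarr 8 (by decide)
  · intro b _ g _
    rw [F6.iarr 10 (by decide), F5.iarr 10 (by decide), F4.iarr 10 (by decide),
      F3.iarr 10 (by decide), F2.iarr 10 (by decide), a10]

end

/-! ### The bounds -/

/-- With `B = (V + m + 1) * 2 ^ k`, both `m + 1` and `k + 1` are at most `B`. Gates are then at most
`B ^ 2`, wires at most `B ^ 3`, and a table has at most `B ^ 4` entries. The largest index bound is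
`B ^ 5`, which is less than `B ^ 6` because `B ≥ 2`. -/
theorem wordBounds {n m k V w : ℕ} (hm : 0 < m) (hn : n ≤ m * (k + 1))
    (hw : w ≤ m * (k + 1) ^ 2) :
    WordBounds (((V + m + 1) * 2 ^ k) ^ 6) n m (k + 1) ∧ m + 2 < ((V + m + 1) * 2 ^ k) ^ 6 ∧
      w < ((V + m + 1) * 2 ^ k) ^ 6 ∧ m * (k + 1) < ((V + m + 1) * 2 ^ k) ^ 6 := by
  set B := (V + m + 1) * 2 ^ k with hB
  have h2k : 1 ≤ 2 ^ k := Nat.one_le_two_pow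
  have hkB : k + 1 ≤ 2 ^ k := Nat.lt_two_pow_self
  have hmB : m + 1 ≤ B := by
    rw [hB]
    calc m + 1 ≤ (V + m + 1) * 1 := by omega
      _ ≤ (V + m + 1) * 2 ^ k := Nat.mul_le_mul_left _ h2k
  have hKB : 2 ^ k ≤ B := Nat.le_mul_of_pos_left _ (by omega)
  clear_value B
  have hkB' := hkB.trans hKB
  have hB2 : 2 ≤ B := by omega
  have hmk : m * (k + 1) ≤ B ^ 2 := by
    rw [pow_two]; exact Nat.mul_le_mul (by omega) hkB'
  have hn2 : n ≤ B ^ 2 := hn.trans hmk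
  have hw3 : w ≤ B ^ 3 := hw.trans (by
    calc m * (k + 1) ^ 2 ≤ B * B ^ 2 := Nat.mul_le_mul (by omega) (Nat.pow_le_pow_left hkB' 2)
      _ = B ^ 3 := by ring)
  have h3 : 3 ^ (k + 1) ≤ B ^ 4 := by
    -- Replacing 3 by 4 turns the size of a table into a power of 2, comparable with `2 ^ k`.
    calc 3 ^ (k + 1) ≤ 4 ^ (k + 1) := Nat.pow_le_pow_left (by norm_num) _
      _ = 2 ^ 2 * (2 ^ k) ^ 2 := by
        rw [pow_succ, show 4 = 2 ^ 2 by norm_num, ← pow_mul, ← pow_mul, Nat.mul_comm 2 k]; ring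
      _ ≤ B ^ 2 * B ^ 2 := Nat.mul_le_mul (Nat.pow_le_pow_left hB2 2) (Nat.pow_le_pow_left hKB 2)
      _ = B ^ 4 := by ring
  have mono : ∀ {i}, i < 6 → B ^ i < B ^ 6 := fun h => Nat.pow_lt_pow_right (by omega) h
  have h8 : 2 ^ 3 ≤ B ^ 3 := Nat.pow_le_pow_left hB2 3
  have hB3 : B ^ 3 < B ^ 6 := mono (by norm_num)
  have hB1 : B < B ^ 2 := by nlinarith
  have hB26 : B ^ 2 < B ^ 6 := mono (by norm_num)
  have hB46 : B ^ 4 < B ^ 6 := mono (by norm_num)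
  have hB56 : B ^ 5 < B ^ 6 := mono (by norm_num)
  have e1 : n * n ≤ B ^ 4 := (Nat.mul_le_mul hn2 hn2).trans_eq (by ring)
  have e2 : (m + 1) * n ≤ B ^ 3 := (Nat.mul_le_mul hmB hn2).trans_eq (by ring)
  have e3 : 3 ^ (k + 1) * (m + 1) ≤ B ^ 5 := (Nat.mul_le_mul h3 hmB).trans_eq (by ring)
  exact ⟨⟨by omega, by omega, by omega, e1.trans_lt hB46, e2.trans_lt hB3, h3.trans_lt hB46,
    e3.trans_lt hB56⟩, by omega, by omega, by omega⟩

/-- Here `M` stands for `3 ^ K`. The dominant term is the number of pairs of table entries per tree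
edge times the quadratic bag check; 2000 is a generous constant. -/
theorem time_le {m K w M : ℕ} (hm : 1 ≤ m) (hK : 1 ≤ K) (hM : 1 ≤ M) (hw : w ≤ m * K ^ 2) :
    7 + ((w * 17 + 6) + ((m * 17 + 6) + (((m + 1) * 21 + 8) + ((m * 33 + 6) +
      (((m + 1) * (K * 15 + M * 16 + 36) + 6) +
      (m * (M * (M * (K * (K * 161 + 291) + 68) + K * 30 + 58) + 38) + 20)))))) ≤
    2000 * (m * (K ^ 2 * M ^ 2)) := by
  have hKK : K ≤ K ^ 2 := Nat.le_self_pow (by norm_num) K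
  have hMM : M ≤ M ^ 2 := Nat.le_self_pow (by norm_num) M
  have hM2 : 1 ≤ M ^ 2 := hM.trans hMM
  have hK2 : 1 ≤ K ^ 2 := hK.trans hKK
  set P := K ^ 2 * M ^ 2 with hP
  have p1 : K ^ 2 ≤ P := Nat.le_mul_of_pos_right _ hM2
  have p2 : M ^ 2 ≤ P := Nat.le_mul_of_pos_left _ hK2
  -- The constants in these estimates are sums of coefficients: 161 + 291 + 68 = 520, 520 + 30 + 58
  -- = 608, 608 + 38 = 646 and 15 + 16 + 36 = 67.
  have e1 : K * (K * 161 + 291) + 68 ≤ 520 * K ^ 2 := by nlinarith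
  have e2 : M * (K * (K * 161 + 291) + 68) ≤ 520 * (K ^ 2 * M) := by nlinarith
  have e3 : K ^ 2 ≤ K ^ 2 * M := Nat.le_mul_of_pos_right _ hM
  have e4 : M * (M * (K * (K * 161 + 291) + 68) + K * 30 + 58) ≤ M * (608 * (K ^ 2 * M)) := by
    gcongr; linarith
  have e5 : M * (608 * (K ^ 2 * M)) = 608 * P := by rw [hP]; ring
  have e6 : m * (M * (M * (K * (K * 161 + 291) + 68) + K * 30 + 58) + 38) ≤ m * (646 * P) := by
    gcongr; linarith
  have e7 : (m + 1) * (K * 15 + M * 16 + 36) ≤ (2 * m) * (67 * P) :=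
    Nat.mul_le_mul (by omega) (by omega)
  have e8 : m ≤ m * P := Nat.le_mul_of_pos_right _ (by omega)
  have e9 : m * K ^ 2 ≤ m * P := Nat.mul_le_mul_left _ p1
  have e10 : (2 * m) * (67 * P) = 134 * (m * P) := by ring
  have e11 : m * (646 * P) = 646 * (m * P) := by ring
  omega

/-- The exponential part uses `9 ^ k ≤ 16 ^ k`, and the polynomial part is absorbed by `2 ^ (ε *
k)`. The rate `a` is chosen so that `exp (a * k) ^ 2 = 2 ^ (ε * k)`, and `1 + x ≤ exp x` gives `μ *
(k + 1) ≤ exp (a * k)` for `μ = min 1 a`. The factor 18000 is 2000 times the 9 left over from the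
exponent `k + 1`. -/
theorem exists_const {ε : ℝ} (hε : 0 < ε) :
    ∃ c : ℝ, 0 ≤ c ∧ ∀ k : ℕ, 2000 * (((k : ℝ) + 1) ^ 2 * ((3 : ℝ) ^ (k + 1)) ^ 2) ≤
      c * (2 : ℝ) ^ ((4 + ε) * (k : ℝ)) := by
  set a : ℝ := ε / 2 * Real.log 2 with ha
  have hlog : 0 < Real.log 2 := Real.log_pos (by norm_num)
  have ha0 : 0 < a := by positivity
  set μ : ℝ := min 1 a with hμ
  have hμ0 : 0 < μ := lt_min one_pos ha0
  refine ⟨18000 * (μ⁻¹) ^ 2, by positivity, fun k => ?_⟩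
  have hk : (0 : ℝ) ≤ k := Nat.cast_nonneg k
  have h1 : μ * ((k : ℝ) + 1) ≤ Real.exp (a * k) := by
    have h2 := Real.add_one_le_exp (a * k)
    have h3 : μ ≤ 1 := min_le_left _ _
    have h4 : μ * k ≤ a * k := mul_le_mul_of_nonneg_right (min_le_right _ _) hk
    linarith
  have h2 : ((k : ℝ) + 1) ^ 2 ≤ (μ⁻¹) ^ 2 * Real.exp (a * k) ^ 2 := by
    rw [← mul_pow]
    refine pow_le_pow_left₀ (by positivity) ?_ 2
    rw [inv_mul_eq_div, le_div_iff₀ hμ0]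
    linarith
  have h3 : Real.exp (a * k) ^ 2 = (2 : ℝ) ^ (ε * (k : ℝ)) := by
    rw [← Real.exp_nat_mul, Real.rpow_def_of_pos (by norm_num), ha]
    congr 1
    push_cast
    ring
  have h4 : ((3 : ℝ) ^ (k + 1)) ^ 2 ≤ 9 * (2 : ℝ) ^ (4 * (k : ℝ)) := by
    have e1 : ((3 : ℝ) ^ (k + 1)) ^ 2 = 9 * 9 ^ k := by
      rw [← pow_mul, Nat.mul_comm, pow_mul, pow_succ]; norm_num [mul_comm]
    have e2 : (2 : ℝ) ^ (4 * (k : ℝ)) = 16 ^ k := by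
      rw [Real.rpow_mul (by norm_num), Real.rpow_natCast]; norm_num
    rw [e1, e2]
    gcongr
    norm_num
  have h5 : (2 : ℝ) ^ ((4 + ε) * (k : ℝ)) = (2 : ℝ) ^ (ε * (k : ℝ)) * (2 : ℝ) ^ (4 * (k : ℝ)) := by
    rw [← Real.rpow_add (by norm_num)]; congr 1; ring
  calc 2000 * (((k : ℝ) + 1) ^ 2 * ((3 : ℝ) ^ (k + 1)) ^ 2)
      ≤ 2000 * (((μ⁻¹) ^ 2 * Real.exp (a * k) ^ 2) * (9 * (2 : ℝ) ^ (4 * (k : ℝ)))) := by gcongr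
    _ = 18000 * (μ⁻¹) ^ 2 * (2 : ℝ) ^ ((4 + ε) * (k : ℝ)) := by rw [h3, h5]; ring

end CircuitProb

/-! ### The corollary -/

theorem mainTheorem7 :
    ∃ (P : CircuitProb.Prog) (d : ℕ),
      ∀ ε : ℝ, 0 < ε →
        ∃ c : ℝ,
          ∀ (n m k : ℕ) (C : CircuitProb.Circuit (Fin n))
            (T : CircuitProb.TreeDecomposition C (Fin m)) (π : C.Var → unitInterval)
            (ws : List (Fin n × Fin n)) (bl : Fin m → List (Fin n)),
            T.width = k → C.ListsWires ws → T.ListsBags bl →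
              ∃ (t : ℕ) (s : CircuitProb.Store),
                CircuitProb.Exec (((Fintype.card C.Var + m + 1) * 2 ^ k) ^ d) P
                  (CircuitProb.inputStore C T π ws bl) t s ∧
                s.rvar 0 = C.prob π ∧
                (t : ℝ) ≤ c * ((Fintype.card C.Var : ℝ) + (m : ℝ) * (2 : ℝ) ^ ((4 + ε) * (k : ℝ))) := by
  -- Program and word exponent do not depend on `ε`, which affects only the constant `c`. The 6 is
  -- the exponent in `wordBounds`.
  refine ⟨CircuitProb.mainProg, 6, fun ε hε => ?_⟩
  obtain ⟨c, hc0, hc⟩ := CircuitProb.exists_const hε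
  refine ⟨c, fun n m k C T π ws bl hk hws hbl => ?_⟩
  have hm : 0 < m := T.root.pos
  have hn := CircuitProb.card_gates_le T
  have hw := CircuitProb.length_wires_le T hws
  rw [hk] at hn hw
  obtain ⟨hW, hmW, hwW, hoW⟩ := CircuitProb.wordBounds (V := Fintype.card C.Var) hm hn hw
  obtain ⟨t, s, h1, h2, h3⟩ := CircuitProb.run_mainProg (T := T) (π := π) hW hmW hwW hoW hws hbl
    (by rw [hk])
  refine ⟨t, s, h1, h3, ?_⟩
  have h4 := h2.trans (CircuitProb.time_le hm (by omega) (Nat.one_le_pow _ 3 (by norm_num)) hw)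
  have h5 : (t : ℝ) ≤ 2000 * ((m : ℝ) * (((k : ℝ) + 1) ^ 2 * ((3 : ℝ) ^ (k + 1)) ^ 2)) := by
    exact_mod_cast h4
  have h6 := mul_le_mul_of_nonneg_left (hc k) (Nat.cast_nonneg (α := ℝ) m)
  -- The |T| term alone already bounds the time; the term with |π| only has to be nonnegative.
  have h7 : 0 ≤ c * (Fintype.card C.Var : ℝ) := by positivity
  rw [mul_add]
  linarith
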